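/- Fix $x_0>0$ and an activation $\sigma(t)=\max\{t,0\}+c\,\max\{-t,0\}$ with $-1<c\le 0$ ($c=0$ is the ReLU, $-1<c<0$ a leaky ReLU). **Networks.** A two-layer network on $\mathbb R^d$ is a function $F(x)=\sum_{i=1}^m w_i\,\sigma(\langle\theta_i,x\rangle-b_i)+w_0$ with $w_i,b_i,w_0\in\mathbb R$, $\theta_i\in\mathbb R^d$. Its path-norm without bias is $\sum_i|w_i|\,\|\theta_i\|_2$, and its path-norm with bias is $\sum_i|w_i|\,\|(\theta_i,b_i)\|_2+|w_0|$. **RKHS.** $\mathcal H_d$ is the reproducing kernel Hilbert space of functions $\mathbb R^d\to\mathbb R$ with kernel $$k(x,y)=\int_{\mathbb S^{d-1}\times\mathbb R}\sigma(\langle\theta,x\rangle-b)\,\sigma(\langle\theta,y\rangle-b)\,d\tau(\theta,b),\qquad \tau=\mathrm{Unif}(\mathbb S^{d-1})\otimes\mathcal N(0,1).$$ **Measures.** For every $d\ge1$ the equation $$\frac{x_0^2}{2s^2}=\log\left(\frac{\sqrt2\,d^2 s}{\sqrt\pi\,x_0}\right)$$ has exactly one solution $s=s_d>0$. Put $$\rho_d(x)=\frac{2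 s_d^{\,d}}{(2\pi)^{d/2}}\,e^{-s_d^2\|x\|^2/2}\,\sin(\sqrt d\,x_1),\qquad x\in\mathbb R^d.$$ **Theorem.** There are constants $K,C>0$, depending only on $x_0$ and $c$, such that the following holds for every $d\ge1$. There exist probability measures $\mu_d,\nu_d$ on $\mathbb R^d$ with finite first moments and with Lebesgue densities whose difference is $\rho_d$. For every such pair: 1. if $d\ge2$, there is a two-layer network $F$ with activation $\sigma$ and path-norm without bias equal to $1$ such that $$\bigl|\mathbb E_{x\sim\mu_d}[F(x)]-\mathbb E_{x\sim\nu_d}[F(x)]\bigr|\ \ge\ \frac{K}{d\log d},$$ and there is also such a network with path-norm with bias equal to $1$; 2. for every $G\in\mathcal H_d$ with $\|G\|_{\mathcal H_d}\le1$, $$\bigl|\mathbb E_{x\sim\mu_d}[G(x)]-\mathbb E_{x\sim\nu_d}[G(x)]\bigr|\ \le\ C\,d\,\exp\left(-\frac{(\sqrt d-1)^2}{16}\right).$$ All these expectations are of integrable functions. -/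

import Mathlib

open MeasureTheory ProbabilityTheory
open scoped ENNReal

noncomputable section

/-- `ℝ^d` with its Euclidean norm. -/
abbrev Euc (d : ℕ) : Type := EuclideanSpace ℝ (Fin d)

/-! ### Activations and two-layer networks -/

/-- The activation `t ↦ (t)₊ + c (-t)₊`: the ReLU for `c = 0`, a leaky ReLU for `-1 < c < 0`. -/
def act (c t : ℝ) : ℝ := max t 0 + c * max (-t) 0

/-- The weights of a two-layer network on `ℝ^d`. -/
structure TwoLayerNet (d : ℕ) where
  /-- number of hidden neurons -/
  m : ℕ
  /-- outer weights -/
  w : Fin m → ℝ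
  /-- inner weights -/
  θ : Fin m → Euc d
  /-- inner biases -/
  b : Fin m → ℝ
  /-- outer bias -/
  w₀ : ℝ

namespace TwoLayerNet

variable {d : ℕ}

/-- The function `x ↦ ∑ wᵢ σ(⟨θᵢ, x⟩ - bᵢ) + w₀`, with `σ = act c`. -/
def eval (c : ℝ) (W : TwoLayerNet d) (x : Euc d) : ℝ :=
  ∑ i, W.w i * act c (inner ℝ (W.θ i) x - W.b i) + W.w₀

/-- Path-norm without bias, `∑ |wᵢ| ‖θᵢ‖₂`. -/
def pathNormNoBias (W : TwoLayerNet d) : ℝ := ∑ i, |W.w i| * ‖W.θ i‖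

/-- Path-norm with bias, `∑ |wᵢ| ‖(θᵢ, bᵢ)‖₂ + |w₀|`. -/
def pathNormBias (W : TwoLayerNet d) : ℝ :=
  ∑ i, |W.w i| * √(‖W.θ i‖ ^ 2 + W.b i ^ 2) + |W.w₀|

end TwoLayerNet

/-! ### The pair of measures -/

/-- The density difference
`ρ(x) = 2 s^d / (2π)^{d/2} * exp (-s² ‖x‖² / 2) * sin (ℓ x₁)`. -/
def rhoDiff (d : ℕ) [NeZero d] (l s : ℝ) (x : Euc d) : ℝ :=
  2 * s ^ d / (2 * Real.pi) ^ ((d : ℝ) / 2) * Real.exp (-(s ^ 2 * ‖x‖ ^ 2) / 2)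
    * Real.sin (l * x 0)

/-- `μ` and `ν` are probability measures on `ℝ^d` with finite first moments and with Lebesgue
densities `p` and `q` such that `p - q = ρ`. -/
structure IsSinePair (d : ℕ) [NeZero d] (l s : ℝ) (μ ν : Measure (Euc d)) : Prop where
  prob_left : IsProbabilityMeasure μ
  prob_right : IsProbabilityMeasure ν
  moment_left : Integrable (fun x : Euc d => ‖x‖) μ
  moment_right : Integrable (fun x : Euc d => ‖x‖) ν
  density : ∃ p q : Euc d → ℝ, Measurable p ∧ Measurable q ∧ (∀ x, 0 ≤ p x) ∧ (∀ x, 0 ≤ q x) ∧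
    μ = volume.withDensity (fun x => ENNReal.ofReal (p x)) ∧
    ν = volume.withDensity (fun x => ENNReal.ofReal (q x)) ∧
    ∀ x, p x - q x = rhoDiff d l s x

/-- `s` is a positive solution of `x₀² / (2 s²) = log (√2 d² s / (√π x₀))`. -/
def IsScale (x₀ : ℝ) (d : ℕ) (s : ℝ) : Prop :=
  0 < s ∧ x₀ ^ 2 / (2 * s ^ 2) = Real.log (√2 * (d : ℝ) ^ 2 * s / (√Real.pi * x₀))

/-! ### The reproducing kernel Hilbert space -/

/-- The uniform probability measure on the unit sphere of `ℝ^d`: normalized surface measure. -/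
def unifSphere (d : ℕ) : Measure (Metric.sphere (0 : Euc d) 1) :=
  ((volume : Measure (Euc d)).toSphere Set.univ)⁻¹ • (volume : Measure (Euc d)).toSphere

/-- `τ = Unif(𝕊^{d-1}) ⊗ N(0, 1)`. -/
def featureMeasure (d : ℕ) : Measure (Metric.sphere (0 : Euc d) 1 × ℝ) :=
  (unifSphere d).prod (gaussianReal 0 1)

/-- The kernel `k(x, y) = ∫ σ(⟨θ, x⟩ - b) σ(⟨θ, y⟩ - b) dτ(θ, b)`, with `σ = act c`. -/
def netKernel (d : ℕ) (c : ℝ) (x y : Euc d) : ℝ :=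
  ∫ z, act c (inner ℝ (z.1 : Euc d) x - z.2) * act c (inner ℝ (z.1 : Euc d) y - z.2)
    ∂(featureMeasure d)

/-- The kernel `k`, with the number `k(x, y)` seen as a linear map `ℝ → ℝ`. -/
def netKernelMatrix (d : ℕ) (c : ℝ) : Matrix (Euc d) (Euc d) (ℝ →L[ℝ] ℝ) :=
  Matrix.of fun x y => netKernel d c x y • ContinuousLinearMap.id ℝ ℝ

instance isFiniteMeasure_unifSphere (d : ℕ) : IsFiniteMeasure (unifSphere d) := by
  refine ⟨lt_of_le_of_lt ?_ ENNReal.one_lt_top⟩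
  simp [unifSphere, ENNReal.inv_mul_le_one]

lemma continuous_act (c : ℝ) : Continuous (act c) := by unfold act; fun_prop

lemma abs_act_le (c t : ℝ) : |act c t| ≤ (1 + |c|) * |t| := by
  have h1 : |max t 0| ≤ |t| := by
    rw [abs_of_nonneg (le_max_right _ _)]; exact max_le (le_abs_self _) (abs_nonneg _)
  have h2 : |max (-t) 0| ≤ |t| := by
    rw [abs_of_nonneg (le_max_right _ _)]; exact max_le (neg_le_abs _) (abs_nonneg _)
  calc |act c t| ≤ |max t 0| + |c * max (-t) 0| := abs_add_le _ _
    _ = |max t 0| + |c| * |max (-t) 0| := by rw [abs_mul]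
    _ ≤ |t| + |c| * |t| := by gcongr
    _ = _ := by ring

lemma memLp_feature (d : ℕ) (c : ℝ) (x : Euc d) :
    MemLp (fun z : Metric.sphere (0 : Euc d) 1 × ℝ => act c (inner ℝ (z.1 : Euc d) x - z.2)) 2
      (featureMeasure d) := by
  have hfin : IsFiniteMeasure (featureMeasure d) := by unfold featureMeasure; infer_instance
  have hb : MemLp (fun z : Metric.sphere (0 : Euc d) 1 × ℝ => z.2) 2 (featureMeasure d) := by
    have h : MemLp (fun b : ℝ => b) 2 (gaussianReal 0 1) := memLp_id_gaussianReal 2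
    exact h.comp_snd (unifSphere d)
  have hg : MemLp (fun z : Metric.sphere (0 : Euc d) 1 × ℝ => (1 + |c|) * (‖x‖ + |z.2|)) 2
      (featureMeasure d) := ((memLp_const ‖x‖).add hb.abs).const_mul _
  refine hg.mono' ?_ (Filter.Eventually.of_forall fun z => ?_)
  · refine Continuous.aestronglyMeasurable ?_
    exact (continuous_act c).comp (by fun_prop)
  · rw [Real.norm_eq_abs]
    refine (abs_act_le _ _).trans ?_
    gcongr
    refine (abs_sub _ _).trans ?_
    gcongr
    refine (abs_real_inner_le_norm _ _).trans ?_
    simp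

/-- The kernel is positive semidefinite, so that it has a reproducing kernel Hilbert space. -/
lemma posSemidef_netKernelMatrix (d : ℕ) (c : ℝ) : (netKernelMatrix d c).PosSemidef := by
  have h := (RKHS.posSemidef_tfae (K := netKernelMatrix d c)).out 0 2
  refine h.2 ⟨?_, fun v => ?_⟩
  · ext x y
    have hid : star (ContinuousLinearMap.id ℝ ℝ) = ContinuousLinearMap.id ℝ ℝ := star_one _
    simp [netKernelMatrix, netKernel, Matrix.conjTranspose_apply, mul_comm, hid]
  · have key : (v.sum fun x w => v.sum fun x' w' =>
          (inner ℝ (netKernelMatrix d c x' x w) w' : ℝ))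
        = ∫ z, (v.sum fun x w => w * act c (inner ℝ (z.1 : Euc d) x - z.2)) ^ 2
            ∂(featureMeasure d) := by
      have hi : ∀ x y : Euc d, Integrable (fun z : Metric.sphere (0 : Euc d) 1 × ℝ =>
          act c (inner ℝ (z.1 : Euc d) x - z.2) * act c (inner ℝ (z.1 : Euc d) y - z.2))
          (featureMeasure d) := fun x y =>
        (memLp_feature d c x).integrable_mul (memLp_feature d c y)
      simp only [Finsupp.sum, netKernelMatrix, netKernel, sq, Finset.sum_mul_sum]
      rw [integral_finsetSum]
      · refine Finset.sum_congr rfl fun x _ => ?_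
        rw [integral_finsetSum]
        · refine Finset.sum_congr rfl fun y _ => ?_
          have : ∀ z : Metric.sphere (0 : Euc d) 1 × ℝ,
              v x * act c (inner ℝ (z.1 : Euc d) x - z.2)
                * (v y * act c (inner ℝ (z.1 : Euc d) y - z.2))
              = (v x * v y) * (act c (inner ℝ (z.1 : Euc d) y - z.2)
                * act c (inner ℝ (z.1 : Euc d) x - z.2)) := fun z => by ring
          simp only [this, integral_const_mul]
          simp
          ring
        · intro y _
          exact ((hi x y).const_mul (v x * v y)).congr
            (Filter.Eventually.of_forall fun z => by simp only; ring)
      · intro x _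
        refine integrable_finsetSum _ fun y _ => ?_
        exact ((hi x y).const_mul (v x * v y)).congr
          (Filter.Eventually.of_forall fun z => by simp only; ring)
    rw [key]
    exact integral_nonneg fun z => sq_nonneg _

instance fact_posSemidef_netKernelMatrix (d : ℕ) (c : ℝ) :
    Fact (netKernelMatrix d c).PosSemidef := ⟨posSemidef_netKernelMatrix d c⟩

/-- The reproducing kernel Hilbert space `ℋ` of functions `ℝ^d → ℝ` with kernel `k`. -/
abbrev NetRKHS (d : ℕ) (c : ℝ) : Type := RKHS.OfKernel (netKernelMatrix d c)

end

/-! Let γ be the Gaussian on `ℝ^d` with covariance s⁻²I. Since `rhoDiff` is its density times 2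
sin(√d x₁), every pair gives the same gap E_μ F − E_ν F = E_γ[2 sin(√d x₁) F(x)]. Such a pair exists
because γ can be reweighted by 1 ± sin(√d x₁).

Networks see the oscillation because a neuron can point along e₁. The second difference of σ with
step h = π/(2√d) is a multiple of a hat supported on half a period, where the sine is nonnegative.
The gap is then of order h² ~ 1/d times the Gaussian density near 0, which is of order s
(`integral_sin_mul_hat_ge`, `act_second_difference`).

The RKHS ball averages over random directions, which are almost orthogonal to e₁. The gap for G is
the inner product of G with the kernel mean embedding of the signed measure, whose squared norm is
the mean square over (θ, b) of E_γ[2 sin(√d x₁) σ(⟨θ,x⟩ − b)] (`NetRKHS.abs_integral_mul_le`). For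
fixed θ, the part of √d e₁ orthogonal to θ gives an independent phase, and averaging over it
produces the factor exp(−d(1 − θ₁²)/(2s²)) (`abs_integral_sin_mul_le`). This is small unless |θ₁| ≥
1/2, and those two caps have exponentially small mass (`unifSphere_cap_le`).

The equation for s enters only through s ≤ 2x₀, s ≥ x₀/(4 log d), 1/s² ≤ 4d²/x₀² and the fact that
s² > 6 forces d to be bounded. -/

open scoped NNReal Pointwise

/-! ### The scaled Gaussian: density, characteristic function, projections. -/

/-- The density of the centred Gaussian measure on `ℝ^d` with covariance `s⁻² I`. -/
noncomputable def gaussDensity (d : ℕ) (s : ℝ) (x : Euc d) : ℝ :=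
  s ^ d / (2 * Real.pi) ^ ((d : ℝ) / 2) * Real.exp (-(s ^ 2 * ‖x‖ ^ 2) / 2)

/-- The centred Gaussian measure on `ℝ^d` with covariance `s⁻² I`. -/
noncomputable def gaussScaled (d : ℕ) (s : ℝ) : Measure (Euc d) :=
  (stdGaussian (Euc d)).map (fun x => s⁻¹ • x)

instance isProbabilityMeasure_gaussScaled (d : ℕ) (s : ℝ) :
    IsProbabilityMeasure (gaussScaled d s) :=
  Measure.isProbabilityMeasure_map (by fun_prop)

instance isGaussian_gaussScaled (d : ℕ) (s : ℝ) : IsGaussian (gaussScaled d s) := by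
  have h := isGaussian_map (μ := stdGaussian (Euc d)) (s⁻¹ • ContinuousLinearMap.id ℝ (Euc d))
  exact h

lemma charFun_gaussScaled (d : ℕ) (s : ℝ) (t : Euc d) :
    charFun (gaussScaled d s) t = Complex.exp (-(‖t‖ ^ 2 / s ^ 2 : ℝ) / 2) := by
  rw [gaussScaled, charFun_map_smul, charFun_stdGaussian, norm_smul]
  congr 1
  push_cast
  rw [mul_pow]
  simp only [norm_inv, Real.norm_eq_abs, inv_pow, ← Complex.ofReal_pow, sq_abs]
  push_cast
  ring

lemma gaussDensity_nonneg {d : ℕ} {s : ℝ} (hs : 0 < s) (x : Euc d) : 0 ≤ gaussDensity d s x := by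
  unfold gaussDensity; positivity

lemma continuous_gaussDensity (d : ℕ) (s : ℝ) : Continuous (gaussDensity d s) := by
  unfold gaussDensity; fun_prop

lemma integral_gaussDensity_mul_cexp {d : ℕ} {s : ℝ} (hs : 0 < s) (t : Euc d) :
    ∫ x : Euc d, (gaussDensity d s x : ℂ) * Complex.exp (inner ℝ x t * Complex.I)
      = Complex.exp (-(‖t‖ ^ 2 / s ^ 2 : ℝ) / 2) := by
  have hb : (0 : ℝ) < ((s ^ 2 / 2 : ℝ) : ℂ).re := by rw [Complex.ofReal_re]; positivity
  have h := GaussianFourier.integral_cexp_neg_mul_sq_norm_add hb Complex.I t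
  have h1 : ∀ x : Euc d, (gaussDensity d s x : ℂ) * Complex.exp (inner ℝ x t * Complex.I)
      = ((s ^ d / (2 * Real.pi) ^ ((d : ℝ) / 2) : ℝ) : ℂ) *
        Complex.exp (-((s ^ 2 / 2 : ℝ) : ℂ) * ‖x‖ ^ 2 + Complex.I * inner ℝ t x) := by
    intro x
    rw [gaussDensity, Complex.exp_add, real_inner_comm]
    push_cast
    rw [show Complex.I * (inner ℝ t x : ℂ) = (inner ℝ t x : ℂ) * Complex.I by ring,
      show -((s : ℂ) ^ 2 * (‖x‖ : ℂ) ^ 2) / 2 = -((s : ℂ) ^ 2 / 2) * ‖x‖ ^ 2 by ring]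
    ring
  simp_rw [h1]
  rw [integral_const_mul, h]
  have h2 : ((Real.pi : ℂ) / ((s ^ 2 / 2 : ℝ) : ℂ)) ^ ((Module.finrank ℝ (Euc d) : ℂ) / 2)
      = (((2 * Real.pi) ^ ((d : ℝ) / 2) / s ^ d : ℝ) : ℂ) := by
    have : (Real.pi : ℂ) / ((s ^ 2 / 2 : ℝ) : ℂ) = ((2 * Real.pi / s ^ 2 : ℝ) : ℂ) := by
      push_cast; field_simp
    rw [this, finrank_euclideanSpace_fin,
      show ((d : ℂ) / 2) = (((d : ℝ) / 2 : ℝ) : ℂ) by push_cast; ring,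
      ← Complex.ofReal_cpow (by positivity)]
    congr 1
    rw [Real.div_rpow (by positivity) (by positivity), ← Real.rpow_natCast s 2,
      ← Real.rpow_mul hs.le, ← Real.rpow_natCast s d]
    congr 2
    push_cast; ring
  rw [h2, ← mul_assoc, ← Complex.ofReal_mul]
  have h3 : s ^ d / (2 * Real.pi) ^ ((d : ℝ) / 2) * ((2 * Real.pi) ^ ((d : ℝ) / 2) / s ^ d) = 1 := by
    field_simp
  rw [h3, Complex.ofReal_one, one_mul]
  congr 1
  rw [Complex.I_sq]
  push_cast
  field_simp
  ring

/-- Otherwise the Bochner integral would take its default value 0, whereas the Fourier formula at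
frequency 0 gives 1. -/
lemma integrable_gaussDensity {d : ℕ} {s : ℝ} (hs : 0 < s) : Integrable (gaussDensity d s) := by
  by_contra hni
  have h := integral_gaussDensity_mul_cexp hs (0 : Euc d)
  simp only [inner_zero_right, Complex.ofReal_zero, zero_mul, Complex.exp_zero, mul_one] at h
  rw [integral_complex_ofReal, integral_undef hni] at h
  simp at h

lemma gaussScaled_eq_withDensity {d : ℕ} {s : ℝ} (hs : 0 < s) :
    gaussScaled d s = volume.withDensity (fun x => ENNReal.ofReal (gaussDensity d s x)) := by
  have : IsFiniteMeasure (volume.withDensity (fun x => ENNReal.ofReal (gaussDensity d s x))) :=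
    isFiniteMeasure_withDensity_ofReal (integrable_gaussDensity hs).2
  refine Measure.ext_of_charFun ?_
  ext t
  rw [charFun_gaussScaled, charFun_apply, integral_withDensity_eq_integral_toReal_smul
    (continuous_gaussDensity d s).measurable.ennreal_ofReal (by simp),
    ← integral_gaussDensity_mul_cexp hs]
  refine integral_congr_ae (.of_forall fun x => ?_)
  simp [ENNReal.toReal_ofReal (gaussDensity_nonneg hs x)]

lemma integral_gaussScaled {d : ℕ} {s : ℝ} (hs : 0 < s) (f : Euc d → ℝ) :
    ∫ x, f x ∂(gaussScaled d s) = ∫ x, gaussDensity d s x * f x := by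
  rw [gaussScaled_eq_withDensity hs, integral_withDensity_eq_integral_toReal_smul
    (continuous_gaussDensity d s).measurable.ennreal_ofReal (by simp)]
  simp [ENNReal.toReal_ofReal (gaussDensity_nonneg hs _)]

lemma integrable_gaussScaled_iff {d : ℕ} {s : ℝ} (hs : 0 < s) (f : Euc d → ℝ) :
    Integrable f (gaussScaled d s) ↔ Integrable fun x => gaussDensity d s x * f x := by
  rw [gaussScaled_eq_withDensity hs, integrable_withDensity_iff_integrable_smul'
    (continuous_gaussDensity d s).measurable.ennreal_ofReal (by simp)]
  simp [ENNReal.toReal_ofReal (gaussDensity_nonneg hs _)]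

lemma integrable_norm_gaussScaled (d : ℕ) (s : ℝ) :
    Integrable (fun x : Euc d => ‖x‖) (gaussScaled d s) :=
  (IsGaussian.integrable_id (μ := gaussScaled d s)).norm

lemma map_inner_gaussScaled {d : ℕ} {s : ℝ} (v : Euc d) :
    (gaussScaled d s).map (fun x => inner ℝ v x)
      = gaussianReal 0 (‖v‖ ^ 2 / s ^ 2).toNNReal := by
  refine Measure.ext_of_charFun ?_
  ext t
  rw [charFun_gaussianReal, charFun_apply_real, integral_map (by fun_prop) (by fun_prop)]
  have h := charFun_gaussScaled d s (t • v)
  rw [charFun_apply] at h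
  have h1 : ∀ x : Euc d, (inner ℝ x (t • v) : ℝ) = t * inner ℝ v x := fun x => by
    rw [inner_smul_right, real_inner_comm]
  simp_rw [h1] at h
  push_cast at h
  rw [h]
  congr 1
  rw [Real.coe_toNNReal _ (by positivity), norm_smul, Real.norm_eq_abs]
  push_cast
  rw [mul_pow, ← Complex.ofReal_pow |t|, sq_abs]
  push_cast
  ring

lemma integral_cexp_inner_gaussScaled {d : ℕ} {s : ℝ} (v : Euc d) :
    ∫ x, Complex.exp ((inner ℝ v x : ℝ) * Complex.I) ∂(gaussScaled d s)
      = (Real.exp (-(‖v‖ ^ 2 / s ^ 2) / 2) : ℝ) := by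
  have h := charFun_gaussScaled d s v
  rw [charFun_apply] at h
  simp_rw [real_inner_comm v] at h
  rw [h]
  push_cast
  rfl

lemma integrable_cexp_inner_gaussScaled {d : ℕ} {s : ℝ} (v : Euc d) :
    Integrable (fun x : Euc d => Complex.exp ((inner ℝ v x : ℝ) * Complex.I)) (gaussScaled d s) := by
  refine (integrable_const (1 : ℝ)).mono' (Continuous.aestronglyMeasurable (by fun_prop))
    (.of_forall fun x => ?_)
  rw [Complex.norm_exp_ofReal_mul_I]

lemma integral_cos_inner_gaussScaled {d : ℕ} {s : ℝ} (v : Euc d) :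
    ∫ x, Real.cos (inner ℝ v x) ∂(gaussScaled d s) = Real.exp (-(‖v‖ ^ 2 / s ^ 2) / 2) := by
  have h := congrArg Complex.re (integral_cexp_inner_gaussScaled (s := s) v)
  rw [← RCLike.re_eq_complex_re, ← integral_re (integrable_cexp_inner_gaussScaled v)] at h
  simpa only [RCLike.re_eq_complex_re, Complex.exp_ofReal_mul_I_re, Complex.ofReal_re] using h

lemma integral_sin_inner_gaussScaled {d : ℕ} {s : ℝ} (v : Euc d) :
    ∫ x, Real.sin (inner ℝ v x) ∂(gaussScaled d s) = 0 := by
  have h := congrArg Complex.im (integral_cexp_inner_gaussScaled (s := s) v)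
  rw [← RCLike.im_eq_complex_im, ← integral_im (integrable_cexp_inner_gaussScaled v)] at h
  simpa only [RCLike.im_eq_complex_im, Complex.exp_ofReal_mul_I_im, Complex.ofReal_im] using h

/-- By Pythagoras the joint characteristic function of the two projections factors. -/
lemma indepFun_inner_gaussScaled {d : ℕ} {s : ℝ} {u v : Euc d} (h : inner ℝ u v = 0) :
    IndepFun (fun x : Euc d => (inner ℝ u x : ℝ)) (fun x => (inner ℝ v x : ℝ))
      (gaussScaled d s) := by
  rw [indepFun_iff_charFun_prod (by fun_prop) (by fun_prop)]
  intro t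
  have hu : ∀ (a : ℝ) (w : Euc d), charFun ((gaussScaled d s).map fun x => (inner ℝ w x : ℝ)) a
      = (Real.exp (-(‖a • w‖ ^ 2 / s ^ 2) / 2) : ℝ) := fun a w => by
    rw [charFun_apply_real, integral_map (by fun_prop) (by fun_prop),
      ← integral_cexp_inner_gaussScaled]
    simp [inner_smul_left]
  rw [hu, hu, charFun_apply, integral_map (by fun_prop) (by fun_prop), ← Complex.ofReal_mul,
    ← Real.exp_add]
  have key : ‖t.ofLp.1 • u + t.ofLp.2 • v‖ ^ 2 = ‖t.ofLp.1 • u‖ ^ 2 + ‖t.ofLp.2 • v‖ ^ 2 := by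
    rw [norm_add_sq_real, inner_smul_left, inner_smul_right, h]; simp
  have e : -(‖t.ofLp.1 • u‖ ^ 2 / s ^ 2) / 2 + -(‖t.ofLp.2 • v‖ ^ 2 / s ^ 2) / 2
      = -(‖t.ofLp.1 • u + t.ofLp.2 • v‖ ^ 2 / s ^ 2) / 2 := by rw [key]; ring
  rw [e, ← integral_cexp_inner_gaussScaled]
  refine integral_congr_ae (.of_forall fun x => ?_)
  simp [WithLp.prod_inner_apply, inner_add_left, inner_smul_left]

/-- Testing a function of `⟨θ, x⟩` against `sin ⟨a, x⟩`: averaging over the directions orthogonal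
to `θ` damps the oscillation. -/
lemma abs_integral_sin_mul_le {d : ℕ} {s : ℝ} {θ : Euc d} (hθ : ‖θ‖ = 1) (a : Euc d) {f : ℝ → ℝ}
    (hf : Continuous f)
    (hi : Integrable (fun x : Euc d => f (inner ℝ θ x)) (gaussScaled d s)) :
    |∫ x, Real.sin (inner ℝ a x) * f (inner ℝ θ x) ∂(gaussScaled d s)|
      ≤ Real.exp (-((‖a‖ ^ 2 - inner ℝ θ a ^ 2) / s ^ 2) / 2)
        * ∫ x, |f (inner ℝ θ x)| ∂(gaussScaled d s) := by
  -- Split a = rθ + v with v ⊥ θ and expand the sine of the sum. The phase ⟨v, x⟩ is independent of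
  -- ⟨θ, x⟩; its sine has mean zero and its cosine has mean exp(−‖v‖²/(2s²)).
  set r : ℝ := inner ℝ θ a
  set v : Euc d := a - r • θ
  have hθθ : (inner ℝ θ θ : ℝ) = 1 := by rw [real_inner_self_eq_norm_sq, hθ]; norm_num
  have hort : inner ℝ θ v = 0 := by
    simp only [v, inner_sub_right, inner_smul_right, hθθ]; simp [r]
  have hv : ‖v‖ ^ 2 = ‖a‖ ^ 2 - r ^ 2 := by
    have : a = r • θ + v := by simp [v]
    conv_rhs => rw [this, norm_add_sq_real, inner_smul_left, hort, norm_smul, hθ]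
    simp
  have hind := indepFun_inner_gaussScaled (s := s) hort
  have hs1 : Integrable (fun x : Euc d => f (inner ℝ θ x) * Real.sin (r * inner ℝ θ x))
      (gaussScaled d s) := by
    refine hi.norm.mono' (Continuous.aestronglyMeasurable (by fun_prop)) (.of_forall fun x => ?_)
    rw [norm_mul]
    exact mul_le_of_le_one_right (norm_nonneg _) (Real.abs_sin_le_one _)
  have hs2 : Integrable (fun x : Euc d => f (inner ℝ θ x) * Real.cos (r * inner ℝ θ x))
      (gaussScaled d s) := by
    refine hi.norm.mono' (Continuous.aestronglyMeasurable (by fun_prop)) (.of_forall fun x => ?_)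
    rw [norm_mul]
    exact mul_le_of_le_one_right (norm_nonneg _) (Real.abs_cos_le_one _)
  have hsplit : ∀ x : Euc d, Real.sin (inner ℝ a x) * f (inner ℝ θ x)
      = f (inner ℝ θ x) * Real.sin (r * inner ℝ θ x) * Real.cos (inner ℝ v x)
        + f (inner ℝ θ x) * Real.cos (r * inner ℝ θ x) * Real.sin (inner ℝ v x) := fun x => by
    have : (inner ℝ a x : ℝ) = r * inner ℝ θ x + inner ℝ v x := by
      simp [v, inner_sub_left, inner_smul_left]
    rw [this, Real.sin_add]; ring
  have h1 := (hind.comp (φ := fun u => f u * Real.sin (r * u)) (ψ := Real.cos)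
    (by fun_prop) (by fun_prop)).integral_fun_mul_eq_mul_integral
    (Continuous.aestronglyMeasurable (by fun_prop)) (Continuous.aestronglyMeasurable (by fun_prop))
  have h2 := (hind.comp (φ := fun u => f u * Real.cos (r * u)) (ψ := Real.sin)
    (by fun_prop) (by fun_prop)).integral_fun_mul_eq_mul_integral
    (Continuous.aestronglyMeasurable (by fun_prop)) (Continuous.aestronglyMeasurable (by fun_prop))
  simp only [Function.comp_def] at h1 h2
  rw [integral_sin_inner_gaussScaled, mul_zero] at h2
  rw [integral_cos_inner_gaussScaled] at h1
  simp_rw [hsplit]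
  rw [integral_add, h1, h2, add_zero, abs_mul, abs_of_pos (Real.exp_pos _), hv, mul_comm]
  · gcongr
    refine abs_integral_le_integral_abs.trans (integral_mono hs1.abs hi.abs fun x => ?_)
    simp only [abs_mul]
    exact mul_le_of_le_one_right (abs_nonneg _) (Real.abs_sin_le_one _)
  · refine hs1.norm.mono' (Continuous.aestronglyMeasurable (by fun_prop)) (.of_forall fun x => ?_)
    rw [norm_mul]
    exact mul_le_of_le_one_right (norm_nonneg _) (Real.abs_cos_le_one _)
  · refine hs2.norm.mono' (Continuous.aestronglyMeasurable (by fun_prop)) (.of_forall fun x => ?_)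
    rw [norm_mul]
    exact mul_le_of_le_one_right (norm_nonneg _) (Real.abs_sin_le_one _)

/-! ### Sine pairs: existence and the expectation gap. -/

section coordinate

variable {d : ℕ} [NeZero d]

lemma inner_single_zero (x : Euc d) : inner ℝ (EuclideanSpace.single (0 : Fin d) (1 : ℝ)) x = x 0 := by
  simp [EuclideanSpace.inner_single_left]

lemma rhoDiff_eq (l s : ℝ) (x : Euc d) :
    rhoDiff d l s x = gaussDensity d s x * (2 * Real.sin (l * x 0)) := by
  unfold rhoDiff gaussDensity; ring

lemma integral_sin_coord_gaussScaled (l s : ℝ) :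
    ∫ x : Euc d, Real.sin (l * x 0) ∂(gaussScaled d s) = 0 := by
  have h := integral_sin_inner_gaussScaled (s := s) (l • EuclideanSpace.single (0 : Fin d) (1 : ℝ))
  simpa only [inner_smul_left, inner_single_zero, RCLike.conj_to_real] using h

lemma integrable_sin_coord_gaussScaled (l s : ℝ) :
    Integrable (fun x : Euc d => Real.sin (l * x 0)) (gaussScaled d s) :=
  (integrable_const (1 : ℝ)).mono' (Continuous.aestronglyMeasurable (by fun_prop))
    (.of_forall fun x => Real.abs_sin_le_one _)

lemma isProbabilityMeasure_sine_density {s : ℝ} (hs : 0 < s) (l : ℝ) :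
    IsProbabilityMeasure (volume.withDensity fun x : Euc d =>
      ENNReal.ofReal (gaussDensity d s x * (1 + Real.sin (l * x 0)))) := by
  have hi : Integrable (fun x : Euc d => 1 + Real.sin (l * x 0)) (gaussScaled d s) :=
    (integrable_const _).add (integrable_sin_coord_gaussScaled l s)
  refine ⟨?_⟩
  rw [withDensity_apply _ .univ, Measure.restrict_univ,
    ← ofReal_integral_eq_lintegral_ofReal ((integrable_gaussScaled_iff hs _).1 hi),
    ← integral_gaussScaled hs, integral_add (integrable_const _)
      (integrable_sin_coord_gaussScaled l s), integral_sin_coord_gaussScaled]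
  · simp
  · refine .of_forall fun x => mul_nonneg (gaussDensity_nonneg hs x) ?_
    linarith [Real.neg_one_le_sin (l * x 0)]

lemma integrable_norm_sine_density {s : ℝ} (hs : 0 < s) (l : ℝ) :
    Integrable (fun x : Euc d => ‖x‖) (volume.withDensity fun x : Euc d =>
      ENNReal.ofReal (gaussDensity d s x * (1 + Real.sin (l * x 0)))) := by
  have hc : Continuous fun x : Euc d => gaussDensity d s x * (1 + Real.sin (l * x 0)) :=
    (continuous_gaussDensity d s).mul (by fun_prop)
  rw [integrable_withDensity_iff_integrable_smul' hc.measurable.ennreal_ofReal (by simp)]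
  have h0 : ∀ x : Euc d, 0 ≤ 1 + Real.sin (l * x 0) := fun x => by
    linarith [Real.neg_one_le_sin (l * x 0)]
  have hi : Integrable (fun x : Euc d => (1 + Real.sin (l * x 0)) * ‖x‖) (gaussScaled d s) := by
    refine ((integrable_norm_gaussScaled d s).const_mul 2).mono'
      (Continuous.aestronglyMeasurable (by fun_prop)) (.of_forall fun x => ?_)
    rw [Real.norm_of_nonneg (mul_nonneg (h0 x) (norm_nonneg x))]
    gcongr
    linarith [Real.sin_le_one (l * x 0)]
  refine ((integrable_gaussScaled_iff hs _).1 hi).congr (.of_forall fun x => ?_)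
  simp only [smul_eq_mul]
  rw [ENNReal.toReal_ofReal (mul_nonneg (gaussDensity_nonneg hs x) (h0 x)), mul_assoc]

/-- The densities are the Gaussian one times 1 ± sin(l x₁): nonnegative, and of mass 1 because the
sine is odd. The minus sign is obtained by replacing l by −l. -/
lemma exists_isSinePair {s : ℝ} (hs : 0 < s) (l : ℝ) :
    ∃ μ ν : Measure (Euc d), IsSinePair d l s μ ν := by
  have hm : ∀ l : ℝ, Measurable fun x : Euc d => gaussDensity d s x * (1 + Real.sin (l * x 0)) :=
    fun l => ((continuous_gaussDensity d s).mul (by fun_prop)).measurable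
  have h0 : ∀ (l : ℝ) (x : Euc d), 0 ≤ gaussDensity d s x * (1 + Real.sin (l * x 0)) :=
    fun l x => mul_nonneg (gaussDensity_nonneg hs x) (by linarith [Real.neg_one_le_sin (l * x 0)])
  refine ⟨_, _, isProbabilityMeasure_sine_density hs l, isProbabilityMeasure_sine_density hs (-l),
    integrable_norm_sine_density hs l, integrable_norm_sine_density hs (-l),
    _, _, hm l, hm (-l), h0 l, h0 (-l), rfl, rfl, fun x => ?_⟩
  rw [rhoDiff_eq, neg_mul, Real.sin_neg]
  ring

/-- The difference of the expectations under a sine pair, as a Gaussian integral. -/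
lemma IsSinePair.integral_sub {l s : ℝ} {μ ν : Measure (Euc d)} (h : IsSinePair d l s μ ν)
    (hs : 0 < s) {F : Euc d → ℝ} (hμ : Integrable F μ) (hν : Integrable F ν) :
    ∫ x, F x ∂μ - ∫ x, F x ∂ν = ∫ x, 2 * Real.sin (l * x 0) * F x ∂(gaussScaled d s) := by
  obtain ⟨p, q, hp, hq, hp0, hq0, rfl, rfl, hpq⟩ := h.density
  rw [integrable_withDensity_iff_integrable_smul' hp.ennreal_ofReal (by simp)] at hμ
  rw [integrable_withDensity_iff_integrable_smul' hq.ennreal_ofReal (by simp)] at hν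
  rw [integral_withDensity_eq_integral_toReal_smul hp.ennreal_ofReal (by simp),
    integral_withDensity_eq_integral_toReal_smul hq.ennreal_ofReal (by simp),
    ← MeasureTheory.integral_sub hμ hν, integral_gaussScaled hs]
  refine integral_congr_ae (.of_forall fun x => ?_)
  simp only [ENNReal.toReal_ofReal (hp0 x), ENNReal.toReal_ofReal (hq0 x), smul_eq_mul]
  rw [← sub_mul, hpq, rhoDiff_eq, mul_assoc]

end coordinate

/-! ### Concentration of the uniform measure on the sphere. -/

lemma isProbabilityMeasure_unifSphere (d : ℕ) [NeZero d] : IsProbabilityMeasure (unifSphere d) := by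
  refine ⟨?_⟩
  have : Nontrivial (Euc d) := inferInstance
  rw [unifSphere, Measure.smul_apply, smul_eq_mul]
  exact ENNReal.inv_mul_cancel
    (Measure.measure_univ_ne_zero.2 (Measure.toSphere_ne_zero _)) (measure_ne_top _ _)

lemma norm_smul_sub_half_le {E : Type*} [NormedAddCommGroup E] [InnerProductSpace ℝ E]
    {e z : E} (he : ‖e‖ = 1) (hz : ‖z‖ = 1) (h : 1 / 2 ≤ inner ℝ e z) {r : ℝ} (h0 : 0 ≤ r)
    (h1 : r ≤ 1) : ‖r • z - (1 / 2 : ℝ) • e‖ ≤ √3 / 2 := by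
  refine abs_le_of_sq_le_sq' ?_ (by positivity) |>.2
  rw [norm_sub_sq_real, norm_smul, norm_smul, inner_smul_left, inner_smul_right, he, hz, div_pow,
    Real.sq_sqrt (by norm_num), real_inner_comm]
  simp only [Real.norm_eq_abs, mul_one, sq_abs, conj_trivial]
  nlinarith [mul_le_mul_of_nonneg_left h h0]

/-- Surface measure is proportional to the volume of the cone over a set. The cone over this cap
fits in a ball of radius √3/2 about e/2, since r² − r⟨e,z⟩ + 1/4 ≤ r² − r/2 + 1/4 ≤ 3/4 for 0 ≤ r ≤
1. -/
lemma toSphere_cap_le (d : ℕ) {e : Euc d} (he : ‖e‖ = 1) :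
    (volume : Measure (Euc d)).toSphere {z | 1 / 2 ≤ inner ℝ e (z : Euc d)}
      ≤ ENNReal.ofReal ((√3 / 2) ^ d) * (volume : Measure (Euc d)).toSphere Set.univ := by
  have hm : MeasurableSet {z : Metric.sphere (0 : Euc d) 1 | 1 / 2 ≤ inner ℝ e (z : Euc d)} :=
    (isClosed_le continuous_const (by fun_prop)).measurableSet
  rw [Measure.toSphere_apply' _ hm, Measure.toSphere_apply_univ, mul_left_comm]
  gcongr
  have hsub : Set.Ioo (0 : ℝ) 1 • (Subtype.val ''
      {z : Metric.sphere (0 : Euc d) 1 | 1 / 2 ≤ inner ℝ e (z : Euc d)})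
      ⊆ Metric.closedBall ((1 / 2 : ℝ) • e) (√3 / 2) := by
    rintro _ ⟨r, hr, _, ⟨z, hz, rfl⟩, rfl⟩
    rw [mem_closedBall_iff_norm]
    exact norm_smul_sub_half_le he (by simp) hz hr.1.le hr.2.le
  refine (measure_mono hsub).trans ?_
  rw [Measure.addHaar_closedBall _ _ (by positivity), finrank_euclideanSpace_fin]

lemma unifSphere_cap_le (d : ℕ) [NeZero d] {e : Euc d} (he : ‖e‖ = 1) :
    (unifSphere d).real {z | 1 / 2 ≤ inner ℝ e (z : Euc d)} ≤ Real.exp (-d / 8) := by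
  have hne := Measure.measure_univ_ne_zero.2
    (Measure.toSphere_ne_zero (volume : Measure (Euc d)))
  have h : unifSphere d {z | 1 / 2 ≤ inner ℝ e (z : Euc d)} ≤ ENNReal.ofReal ((√3 / 2) ^ d) := by
    rw [unifSphere, Measure.smul_apply, smul_eq_mul]
    grw [toSphere_cap_le d he]
    rw [mul_left_comm, ENNReal.inv_mul_cancel hne (measure_ne_top _ _), mul_one]
  -- After squaring this is 1 − 1/4 ≤ exp(−1/4).
  have h2 : √3 / 2 ≤ Real.exp (-1 / 8) := by
    refine abs_le_of_sq_le_sq' ?_ (Real.exp_pos _).le |>.2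
    rw [div_pow, Real.sq_sqrt (by norm_num), ← Real.exp_nat_mul]
    have := Real.add_one_le_exp (((2 : ℕ) : ℝ) * (-1 / 8))
    norm_num at this ⊢
    linarith
  refine (ENNReal.toReal_le_of_le_ofReal (by positivity) h).trans ?_
  calc (√3 / 2) ^ d ≤ Real.exp (-1 / 8) ^ d := by gcongr
    _ = Real.exp (-d / 8) := by rw [← Real.exp_nat_mul]; ring_nf

/-- The integrand is at most 1 on the two caps around ±e; off them ⟨e,z⟩² ≤ 1/4, which yields the
exponent 3a/4. -/
lemma integral_exp_unifSphere_le (d : ℕ) [NeZero d] {e : Euc d} (he : ‖e‖ = 1) {a : ℝ}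
    (ha : 0 ≤ a) :
    ∫ z, Real.exp (-(a * (1 - inner ℝ e (z : Euc d) ^ 2))) ∂(unifSphere d)
      ≤ 2 * Real.exp (-d / 8) + Real.exp (-(3 / 4 * a)) := by
  have := isProbabilityMeasure_unifSphere d
  set A : Euc d → Set (Metric.sphere (0 : Euc d) 1) := fun e => {z | 1 / 2 ≤ inner ℝ e (z : Euc d)}
  have hA : ∀ e, MeasurableSet (A e) := fun e =>
    (isClosed_le continuous_const (by fun_prop)).measurableSet
  have hle : ∀ z : Metric.sphere (0 : Euc d) 1,
      Real.exp (-(a * (1 - inner ℝ e (z : Euc d) ^ 2)))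
        ≤ (A e).indicator 1 z + (A (-e)).indicator 1 z + Real.exp (-(3 / 4 * a)) := by
    intro z
    have hz : |(inner ℝ e (z : Euc d) : ℝ)| ≤ 1 := by
      simpa [he] using abs_real_inner_le_norm e (z : Euc d)
    have hz2 : (inner ℝ e (z : Euc d) : ℝ) ^ 2 ≤ 1 := by
      rw [← sq_abs]; exact pow_le_one₀ (abs_nonneg _) hz
    have h1 : Real.exp (-(a * (1 - inner ℝ e (z : Euc d) ^ 2))) ≤ 1 := by
      rw [Real.exp_le_one_iff, neg_nonpos]
      exact mul_nonneg ha (by linarith)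
    have hn : ∀ e, (0 : ℝ) ≤ (A e).indicator 1 z := fun e =>
      Set.indicator_nonneg (fun _ _ => zero_le_one) _
    have hp := Real.exp_pos (-(3 / 4 * a))
    by_cases h : z ∈ A e
    · have : (A e).indicator (1 : Metric.sphere (0 : Euc d) 1 → ℝ) z = 1 := Set.indicator_of_mem h _
      linarith [hn (-e)]
    by_cases h' : z ∈ A (-e)
    · have : (A (-e)).indicator (1 : Metric.sphere (0 : Euc d) 1 → ℝ) z = 1 := Set.indicator_of_mem h' _
      linarith [hn e]
    have hb : Real.exp (-(a * (1 - inner ℝ e (z : Euc d) ^ 2))) ≤ Real.exp (-(3 / 4 * a)) := by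
      simp only [A, Set.mem_ofPred_eq, not_le, inner_neg_left] at h h'
      rw [Real.exp_le_exp]
      have hq : (inner ℝ e (z : Euc d) : ℝ) ^ 2 ≤ 1 / 4 := by nlinarith
      linarith [mul_le_mul_of_nonneg_left hq ha]
    linarith [hn e, hn (-e)]
  have hi : ∀ e, Integrable ((A e).indicator (1 : Metric.sphere (0 : Euc d) 1 → ℝ)) (unifSphere d) := fun e =>
    (integrable_const (1 : ℝ)).indicator (hA e)
  have hcap : ∀ e : Euc d, ‖e‖ = 1 →
      ∫ z, (A e).indicator (1 : Metric.sphere (0 : Euc d) 1 → ℝ) z ∂(unifSphere d) ≤ Real.exp (-d / 8) := fun e he => by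
    rw [integral_indicator_one (hA e)]; exact unifSphere_cap_le d he
  calc _ ≤ ∫ z, ((A e).indicator 1 z + (A (-e)).indicator 1 z + Real.exp (-(3 / 4 * a)))
        ∂(unifSphere d) := by
        refine integral_mono_of_nonneg (.of_forall fun z => (Real.exp_pos _).le) ?_ (.of_forall hle)
        exact ((hi e).add (hi (-e))).add (integrable_const _)
    _ ≤ _ := by
        have hadd : Integrable (fun z => (A e).indicator (1 : Metric.sphere (0 : Euc d) 1 → ℝ) z
            + (A (-e)).indicator 1 z) (unifSphere d) := (hi e).add (hi (-e))
        rw [integral_add hadd (integrable_const _), integral_add (hi e) (hi (-e))]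
        simp only [integral_const, probReal_univ, one_smul]
        linarith [hcap e he, hcap (-e) (by rwa [norm_neg])]

/-! ### The scale s: existence, uniqueness and size. -/

namespace IsScale

variable {x₀ : ℝ} {d : ℕ} {s : ℝ}

lemma existsUnique (hx₀ : 0 < x₀) (hd : 1 ≤ d) : ∃! s : ℝ, IsScale x₀ d s := by
  have hd0 : (0 : ℝ) < d := by exact_mod_cast hd
  set κ : ℝ := √2 * (d : ℝ) ^ 2 / (√Real.pi * x₀) with hκ
  have hκ0 : 0 < κ := by have := Real.pi_pos; positivity
  have hκs : ∀ s : ℝ, √2 * (d : ℝ) ^ 2 * s / (√Real.pi * x₀) = κ * s := fun s => by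
    rw [hκ]; ring
  have hmono : ∀ {s t : ℝ}, IsScale x₀ d s → IsScale x₀ d t → ¬ s < t := by
    rintro s t ⟨hs, hs'⟩ ⟨ht, ht'⟩ hst
    rw [hκs] at hs' ht'
    have h1 : x₀ ^ 2 / (2 * t ^ 2) < x₀ ^ 2 / (2 * s ^ 2) := by gcongr
    have h2 : Real.log (κ * s) < Real.log (κ * t) :=
      Real.log_lt_log (by positivity) (by gcongr)
    linarith
  -- Endpoints for the intermediate value theorem: at 1/κ the logarithm vanishes; at b it is at
  -- least 1, while b ≥ x₀ keeps the quotient at most 1.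
  set b : ℝ := Real.exp 1 / κ + x₀
  have hab : 1 / κ ≤ b := by
    have : 1 / κ ≤ Real.exp 1 / κ := by gcongr; linarith [Real.add_one_le_exp (1 : ℝ)]
    linarith
  have hc : ContinuousOn (fun s : ℝ => x₀ ^ 2 / (2 * s ^ 2) - Real.log (κ * s))
      (Set.Icc (1 / κ) b) := by
    have hpos : ∀ s ∈ Set.Icc (1 / κ) b, s ≠ 0 := fun s hs =>
      (lt_of_lt_of_le (by positivity) hs.1).ne'
    refine ContinuousOn.sub (ContinuousOn.div continuousOn_const (by fun_prop) fun s hs => ?_)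
      (ContinuousOn.log (by fun_prop) fun s hs => ?_)
    · have := hpos s hs; positivity
    · exact mul_ne_zero hκ0.ne' (hpos s hs)
  have hmem : (0 : ℝ) ∈ Set.Icc (x₀ ^ 2 / (2 * b ^ 2) - Real.log (κ * b))
      (x₀ ^ 2 / (2 * (1 / κ) ^ 2) - Real.log (κ * (1 / κ))) := by
    constructor
    · have h1 : 1 ≤ Real.log (κ * b) := by
        rw [Real.le_log_iff_exp_le (by positivity)]
        have : κ * b = Real.exp 1 + κ * x₀ := by simp only [b]; field_simp
        rw [this]; linarith [mul_pos hκ0 hx₀]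
      have h2 : x₀ ^ 2 / (2 * b ^ 2) ≤ 1 := by
        have hb : x₀ ≤ b := by simp only [b]; linarith [div_pos (Real.exp_pos 1) hκ0]
        rw [div_le_one (by positivity)]
        nlinarith
      linarith
    · rw [mul_one_div_cancel hκ0.ne', Real.log_one, sub_zero]
      positivity
  obtain ⟨s, hs, hs0⟩ := intermediate_value_Icc' hab hc hmem
  have hsc : IsScale x₀ d s := by
    refine ⟨lt_of_lt_of_le (by positivity) hs.1, ?_⟩
    rw [hκs]
    linarith
  exact ⟨s, hsc, fun t ht => le_antisymm (not_lt.1 (hmono hsc ht)) (not_lt.1 (hmono ht hsc))⟩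

/-- If s > 2x₀, the left side of the equation is below 1/8, while √π ≤ 2 makes the right side at
least (log 2)/2. -/
lemma le_two_mul (h : IsScale x₀ d s) (hx₀ : 0 < x₀) (hd : 1 ≤ d) : s ≤ 2 * x₀ := by
  obtain ⟨hs, h⟩ := h
  by_contra! hlt
  have hd1 : (1 : ℝ) ≤ (d : ℝ) ^ 2 := one_le_pow₀ (by exact_mod_cast hd)
  have hpi : √Real.pi ≤ 2 := by
    rw [Real.sqrt_le_left (by norm_num)]; linarith [Real.pi_le_four]
  have hpi0 : 0 < √Real.pi := Real.sqrt_pos.2 Real.pi_pos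
  have h2 : √2 ≤ √2 * (d : ℝ) ^ 2 * s / (√Real.pi * x₀) := by
    have : √Real.pi * x₀ ≤ (d : ℝ) ^ 2 * s := by
      nlinarith [mul_le_mul_of_nonneg_right hpi hx₀.le, mul_le_mul_of_nonneg_right hd1 hs.le]
    rw [le_div_iff₀ (by positivity), mul_assoc √2]
    gcongr
  have h3 : Real.log 2 / 2 ≤ x₀ ^ 2 / (2 * s ^ 2) := by
    rw [h, ← Real.log_sqrt (by norm_num)]
    exact Real.log_le_log (by positivity) h2
  have h4 : x₀ ^ 2 / (2 * s ^ 2) < 1 / 8 := by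
    rw [div_lt_div_iff₀ (by positivity) (by norm_num)]
    nlinarith
  linarith [Real.log_two_gt_d9]

/-- For s ≤ x₀ the argument of the logarithm is at most d², because √2 ≤ √π. -/
lemma sq_div_sq_le (h : IsScale x₀ d s) (hx₀ : 0 < x₀) (hd : 1 ≤ d) :
    x₀ ^ 2 / s ^ 2 ≤ max 1 (4 * Real.log d) := by
  obtain ⟨hs, h⟩ := h
  have hd0 : (0 : ℝ) < d := by exact_mod_cast hd
  rcases le_total x₀ s with hle | hle
  · refine le_max_of_le_left ?_
    rw [div_le_one (by positivity)]
    gcongr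
  · refine le_max_of_le_right ?_
    have hpi : √2 ≤ √Real.pi := Real.sqrt_le_sqrt (by linarith [Real.pi_gt_three])
    have hpi0 : 0 < √Real.pi := Real.sqrt_pos.2 Real.pi_pos
    have h1 : Real.log (√2 * (d : ℝ) ^ 2 * s / (√Real.pi * x₀)) ≤ Real.log ((d : ℝ) ^ 2) := by
      refine Real.log_le_log (by positivity) ?_
      rw [div_le_iff₀ (by positivity)]
      calc √2 * (d : ℝ) ^ 2 * s ≤ √Real.pi * (d : ℝ) ^ 2 * x₀ := by gcongr
        _ = _ := by ring
    rw [Real.log_pow, ← h] at h1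
    push_cast at h1
    have : x₀ ^ 2 / s ^ 2 = 2 * (x₀ ^ 2 / (2 * s ^ 2)) := by field_simp
    linarith

lemma inv_sq_le (h : IsScale x₀ d s) (hx₀ : 0 < x₀) (hd : 1 ≤ d) :
    1 / s ^ 2 ≤ 4 * (d : ℝ) ^ 2 / x₀ ^ 2 := by
  have h1 := h.sq_div_sq_le hx₀ hd
  have hs := h.1
  have hd1 : (1 : ℝ) ≤ d := by exact_mod_cast hd
  have h2 : max 1 (4 * Real.log d) ≤ 4 * (d : ℝ) ^ 2 :=
    max_le (by nlinarith) (by nlinarith [Real.log_le_self (by linarith : (0 : ℝ) ≤ d)])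
  rw [le_div_iff₀ (by positivity), one_div_mul_eq_div]
  exact h1.trans h2

lemma div_log_le (h : IsScale x₀ d s) (hx₀ : 0 < x₀) (hd : 2 ≤ d) :
    x₀ / (4 * Real.log d) ≤ s := by
  have h1 := h.sq_div_sq_le hx₀ (by omega)
  have hs := h.1
  have hl : 1 ≤ 4 * Real.log d := by
    have : Real.log 2 ≤ Real.log d := Real.log_le_log (by norm_num) (by exact_mod_cast hd)
    linarith [Real.log_two_gt_d9]
  rw [max_eq_right hl, ← div_pow] at h1
  rw [div_le_iff₀ (by linarith), ← div_le_iff₀' hs]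
  rcases le_total (x₀ / s) 1 with hle | hle
  · linarith
  · nlinarith

/-- For s² ≤ 6 the exponent is already at least d/8. For s² ≥ 6 the scale equation gives d ≤ √π x₀
exp(x₀²/12), so the constant factor compensates for exp(−d/8). -/
lemma exp_neg_div_sq_le (h : IsScale x₀ d s) (hx₀ : 0 < x₀) (hd : 1 ≤ d) :
    Real.exp (-(3 / 4 * (d / s ^ 2)))
      ≤ Real.exp (√Real.pi * x₀ * Real.exp (x₀ ^ 2 / 12) / 8) * Real.exp (-d / 8) := by
  obtain ⟨hs, h⟩ := h
  have hd1 : (1 : ℝ) ≤ d := by exact_mod_cast hd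
  have hpi0 : 0 < √Real.pi := Real.sqrt_pos.2 Real.pi_pos
  rw [← Real.exp_add, Real.exp_le_exp]
  have hD : 0 < √Real.pi * x₀ * Real.exp (x₀ ^ 2 / 12) := by positivity
  rcases le_total (s ^ 2) 6 with hle | hle
  · have : (d : ℝ) / 6 ≤ d / s ^ 2 := by gcongr
    linarith
  · have h1 : x₀ ^ 2 / (2 * s ^ 2) ≤ x₀ ^ 2 / 12 := by gcongr; linarith
    rw [h, Real.log_le_iff_le_exp (by positivity), div_le_iff₀ (by positivity)] at h1
    have h2 : 1 ≤ √2 * s := by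
      have : 1 ≤ √2 := Real.one_le_sqrt.2 (by norm_num)
      nlinarith
    have h3 : (d : ℝ) ≤ √2 * (d : ℝ) ^ 2 * s := by
      nlinarith [mul_le_mul_of_nonneg_left h2 (sq_nonneg (d : ℝ))]
    have h4 : 0 ≤ (d : ℝ) / s ^ 2 := by positivity
    nlinarith

end IsScale

/-! ### The activation and the random features. -/

/-- Both coefficients are nonnegative with sum 1 when −1 < c ≤ 0, which makes σ 1-Lipschitz; the
linear term disappears in second differences. -/
lemma act_eq (c t : ℝ) : act c t = (1 + c) / 2 * |t| + (1 - c) / 2 * t := by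
  unfold act
  rcases le_total 0 t with h | h
  · rw [max_eq_left h, max_eq_right (neg_nonpos.2 h), abs_of_nonneg h]; ring
  · rw [max_eq_right h, max_eq_left (neg_nonneg.2 h), abs_of_nonpos h]; ring

lemma abs_act_sub_le {c : ℝ} (hc : -1 < c) (hc' : c ≤ 0) (t u : ℝ) :
    |act c t - act c u| ≤ |t - u| := by
  have h1 := abs_abs_sub_abs_le t u
  have e : act c t - act c u = (1 + c) / 2 * (|t| - |u|) + (1 - c) / 2 * (t - u) := by
    rw [act_eq, act_eq]; ring
  rw [e]
  refine (abs_add_le _ _).trans ?_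
  rw [abs_mul, abs_mul, abs_of_pos (by linarith : 0 < (1 + c) / 2),
    abs_of_pos (by linarith : 0 < (1 - c) / 2)]
  nlinarith

lemma abs_act_le_abs {c : ℝ} (hc : -1 < c) (hc' : c ≤ 0) (t : ℝ) : |act c t| ≤ |t| := by
  simpa [act] using abs_act_sub_le hc hc' t 0

/-- The feature `x ↦ σ(⟨θ, x⟩ - b)` at `z = (θ, b)`. -/
noncomputable def feature {d : ℕ} (c : ℝ) (x : Euc d) (z : Metric.sphere (0 : Euc d) 1 × ℝ) : ℝ :=
  act c (inner ℝ (z.1 : Euc d) x - z.2)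

section features

variable {d : ℕ} {c : ℝ}

lemma continuous_feature : Continuous fun p : Euc d × (Metric.sphere (0 : Euc d) 1 × ℝ) =>
    feature c p.1 p.2 :=
  (continuous_act c).comp (by fun_prop)

lemma abs_feature_le (hc : -1 < c) (hc' : c ≤ 0) (x : Euc d)
    (z : Metric.sphere (0 : Euc d) 1 × ℝ) : |feature c x z| ≤ ‖x‖ + |z.2| := by
  refine (abs_act_le_abs hc hc' _).trans ((abs_sub _ _).trans ?_)
  gcongr
  simpa using abs_real_inner_le_norm (z.1 : Euc d) x

lemma abs_feature_sub_le (hc : -1 < c) (hc' : c ≤ 0) (x y : Euc d)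
    (z : Metric.sphere (0 : Euc d) 1 × ℝ) : |feature c x z - feature c y z| ≤ ‖x - y‖ := by
  refine (abs_act_sub_le hc hc' _ _).trans ?_
  rw [sub_sub_sub_cancel_right, ← inner_sub_right]
  simpa using abs_real_inner_le_norm (z.1 : Euc d) (x - y)

instance isFiniteMeasure_featureMeasure (d : ℕ) : IsFiniteMeasure (featureMeasure d) := by
  unfold featureMeasure; infer_instance

lemma isProbabilityMeasure_featureMeasure (d : ℕ) [NeZero d] :
    IsProbabilityMeasure (featureMeasure d) := by
  have := isProbabilityMeasure_unifSphere d
  unfold featureMeasure; infer_instance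

lemma netKernel_eq (x y : Euc d) :
    netKernel d c x y = ∫ z, feature c x z * feature c y z ∂(featureMeasure d) := rfl

lemma memLp_feature' (x : Euc d) : MemLp (feature c x) 2 (featureMeasure d) :=
  memLp_feature d c x

lemma integrable_feature_mul (x y : Euc d) :
    Integrable (fun z => feature c x z * feature c y z) (featureMeasure d) :=
  (memLp_feature' x).integrable_mul (memLp_feature' y)

lemma memLp_bias (d : ℕ) :
    MemLp (fun z : Metric.sphere (0 : Euc d) 1 × ℝ => z.2) 2 (featureMeasure d) :=
  MemLp.comp_snd (f := fun b : ℝ => b) (memLp_id_gaussianReal 2) (unifSphere d)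

end features

/-! ### Kernel sections in the RKHS. -/

namespace NetRKHS

variable {d : ℕ} {c : ℝ}

/-- The kernel section `k(x, ·)` as an element of the reproducing kernel Hilbert space. -/
noncomputable def kerSection (d : ℕ) (c : ℝ) (x : Euc d) : NetRKHS d c :=
  RKHS.kerFun (NetRKHS d c) x (1 : ℝ)

lemma inner_kerSection (x : Euc d) (G : NetRKHS d c) :
    inner ℝ (kerSection d c x) G = G x := by
  rw [kerSection, RKHS.kerFun_inner]
  simp

lemma inner_kerSection_kerSection (x y : Euc d) :
    inner ℝ (kerSection d c x) (kerSection d c y) = netKernel d c x y := by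
  rw [inner_kerSection, kerSection, RKHS.kerFun_apply, RKHS.OfKernel.kernel_ofKernel]
  simp [netKernelMatrix]

/-- The squared distance of two sections is the mean square difference of 1-Lipschitz features.
Continuity and linear growth of sections follow, hence the integrability of every G under a finite
first moment. -/
lemma norm_kerSection_sub_le [NeZero d] (hc : -1 < c) (hc' : c ≤ 0) (x y : Euc d) :
    ‖kerSection d c x - kerSection d c y‖ ≤ ‖x - y‖ := by
  have := isProbabilityMeasure_featureMeasure d
  refine abs_le_of_sq_le_sq' ?_ (norm_nonneg _) |>.2
  have h : ‖kerSection d c x - kerSection d c y‖ ^ 2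
      = ∫ z, (feature c x z - feature c y z) ^ 2 ∂(featureMeasure d) := by
    rw [norm_sub_sq_real, ← real_inner_self_eq_norm_sq, ← real_inner_self_eq_norm_sq]
    simp only [inner_kerSection_kerSection, netKernel_eq]
    have hsub : Integrable (fun z => feature c x z * feature c x z
        - 2 * (feature c x z * feature c y z)) (featureMeasure d) :=
      (integrable_feature_mul x x).sub ((integrable_feature_mul x y).const_mul 2)
    rw [← integral_const_mul, ← integral_sub (integrable_feature_mul x x)
      ((integrable_feature_mul x y).const_mul 2), ← integral_add hsub (integrable_feature_mul y y)]
    refine integral_congr_ae (.of_forall fun z => ?_)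
    ring
  rw [h]
  calc _ ≤ ∫ _, ‖x - y‖ ^ 2 ∂(featureMeasure d) := by
        refine integral_mono_of_nonneg (.of_forall fun z => sq_nonneg _) (integrable_const _)
          (.of_forall fun z => ?_)
        simp only
        rw [← sq_abs]
        gcongr
        exact abs_feature_sub_le hc hc' x y z
    _ = _ := by simp

lemma continuous_kerSection [NeZero d] (hc : -1 < c) (hc' : c ≤ 0) :
    Continuous (kerSection d c) :=
  (LipschitzWith.of_dist_le_mul (K := 1) fun x y => by
    simpa [dist_eq_norm] using norm_kerSection_sub_le hc hc' x y).continuous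

lemma norm_kerSection_le [NeZero d] (hc : -1 < c) (hc' : c ≤ 0) (x : Euc d) :
    ‖kerSection d c x‖ ≤ ‖kerSection d c 0‖ + ‖x‖ := by
  have h1 := norm_kerSection_sub_le hc hc' x 0
  have h2 := norm_sub_norm_le (kerSection d c x) (kerSection d c 0)
  rw [sub_zero] at h1
  linarith

lemma integrable_coe [NeZero d] (hc : -1 < c) (hc' : c ≤ 0) (G : NetRKHS d c)
    {μ : Measure (Euc d)} [IsFiniteMeasure μ] (hμ : Integrable (fun x : Euc d => ‖x‖) μ) :
    Integrable (fun x => G x) μ := by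
  simp_rw [← inner_kerSection]
  refine (((integrable_const ‖kerSection d c 0‖).add hμ).mul_const ‖G‖).mono'
    (Continuous.aestronglyMeasurable
      ((continuous_kerSection hc hc').inner continuous_const)) (.of_forall fun x => ?_)
  refine (norm_inner_le_norm _ _).trans ?_
  gcongr
  exact norm_kerSection_le hc hc' x

end NetRKHS

/-! ### Kernel mean embedding of a signed measure. -/

section embedding

variable {d : ℕ} {c : ℝ} {γ : Measure (Euc d)} [IsProbabilityMeasure γ] {u : Euc d → ℝ}
  {M : ℝ}

/-- The feature coefficient `∫ u(x) σ(⟨θ, x⟩ - b) dγ(x)` of the signed measure `u γ`. -/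
noncomputable def featureCoeff (c : ℝ) (γ : Measure (Euc d)) (u : Euc d → ℝ)
    (z : Metric.sphere (0 : Euc d) 1 × ℝ) : ℝ := ∫ x, u x * feature c x z ∂γ

lemma abs_featureCoeff_le (hc : -1 < c) (hc' : c ≤ 0) (hM : ∀ x, |u x| ≤ M)
    (hγ : Integrable (fun x : Euc d => ‖x‖) γ) (z : Metric.sphere (0 : Euc d) 1 × ℝ) :
    |featureCoeff c γ u z| ≤ M * (∫ x, ‖x‖ ∂γ + |z.2|) := by
  have hM0 : 0 ≤ M := (abs_nonneg _).trans (hM 0)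
  calc |featureCoeff c γ u z| ≤ ∫ x, |u x * feature c x z| ∂γ := abs_integral_le_integral_abs
    _ ≤ ∫ x, M * (‖x‖ + |z.2|) ∂γ := by
        refine integral_mono_of_nonneg (.of_forall fun x => abs_nonneg _)
          ((hγ.add (integrable_const |z.2|)).const_mul M) (.of_forall fun x => ?_)
        simp only [abs_mul]
        exact mul_le_mul (hM x) (abs_feature_le hc hc' x z) (abs_nonneg _) hM0
    _ = _ := by
        rw [integral_const_mul, integral_add hγ (integrable_const _)]
        simp

lemma stronglyMeasurable_featureCoeff (hu : Continuous u) :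
    StronglyMeasurable (featureCoeff c γ u) := by
  have h : Continuous fun p : (Metric.sphere (0 : Euc d) 1 × ℝ) × Euc d =>
      u p.2 * feature c p.2 p.1 :=
    (hu.comp continuous_snd).mul (continuous_feature.comp continuous_swap)
  exact h.stronglyMeasurable.integral_prod_right

/-- Fubini, stated for any h of linear growth in the bias because it serves twice: with h a feature
it evaluates the embedding, with h the feature coefficients it computes its norm. -/
lemma integral_mul_integral_feature (hc : -1 < c) (hc' : c ≤ 0) (hu : Continuous u)
    (hM : ∀ x, |u x| ≤ M) (hγ : Integrable (fun x : Euc d => ‖x‖) γ)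
    {h : Metric.sphere (0 : Euc d) 1 × ℝ → ℝ} (hh : StronglyMeasurable h) {A B : ℝ}
    (hb : ∀ z, |h z| ≤ A * (B + |z.2|)) :
    ∫ x, u x * ∫ z, feature c x z * h z ∂(featureMeasure d) ∂γ
      = ∫ z, featureCoeff c γ u z * h z ∂(featureMeasure d) := by
  have hM0 : 0 ≤ M := (abs_nonneg _).trans (hM 0)
  have hbias : Integrable (fun z : Metric.sphere (0 : Euc d) 1 × ℝ => |z.2|) (featureMeasure d) :=
    ((memLp_bias d).integrable (by norm_num)).abs
  have hsq : Integrable (fun z : Metric.sphere (0 : Euc d) 1 × ℝ => |z.2| * |z.2|)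
      (featureMeasure d) := (memLp_bias d).abs.integrable_mul (memLp_bias d).abs
  have hint : Integrable (Function.uncurry fun (x : Euc d) z => u x * (feature c x z * h z))
      (γ.prod (featureMeasure d)) := by
    have h1 : Integrable (fun p : Euc d × (Metric.sphere (0 : Euc d) 1 × ℝ) =>
        ‖p.1‖ * (A * (B + |p.2.2|))) (γ.prod (featureMeasure d)) :=
      hγ.mul_prod (((integrable_const B).add hbias).const_mul A)
    have h2 : Integrable (fun p : Euc d × (Metric.sphere (0 : Euc d) 1 × ℝ) =>
        A * (B * |p.2.2| + |p.2.2| * |p.2.2|)) (γ.prod (featureMeasure d)) :=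
      Integrable.comp_snd (((hbias.const_mul B).add hsq).const_mul A) γ
    refine ((h1.add h2).const_mul M).mono' ?_ (.of_forall fun p => ?_)
    · exact (hu.comp continuous_fst).aestronglyMeasurable.mul
        (continuous_feature.aestronglyMeasurable.mul
          (hh.comp_measurable measurable_snd).aestronglyMeasurable)
    · simp only [Function.uncurry, norm_mul, Real.norm_eq_abs, Pi.add_apply]
      refine (mul_le_mul (hM p.1) (mul_le_mul (abs_feature_le hc hc' p.1 p.2) (hb p.2)
        (abs_nonneg _) (by positivity)) (by positivity) hM0).trans_eq ?_
      ring
  simp_rw [← integral_const_mul]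
  rw [integral_integral_swap hint]
  refine integral_congr_ae (.of_forall fun z => ?_)
  simp only [featureCoeff]
  rw [← integral_mul_const]
  simp_rw [mul_assoc]

/-- Integrating an element of the unit ball of the reproducing kernel Hilbert space against `u γ`
is controlled by the `L²` norm of the feature coefficients of `u γ`. -/
lemma NetRKHS.abs_integral_mul_le [NeZero d] (hc : -1 < c) (hc' : c ≤ 0) (hu : Continuous u)
    (hM : ∀ x, |u x| ≤ M) (hγ : Integrable (fun x : Euc d => ‖x‖) γ) (G : NetRKHS d c)
    (hG : ‖G‖ ≤ 1) :
    |∫ x, u x * G x ∂γ| ≤ √(∫ z, featureCoeff c γ u z ^ 2 ∂(featureMeasure d)) := by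
  have hint : Integrable (fun x => u x • NetRKHS.kerSection d c x) γ := by
    refine (((integrable_const ‖kerSection d c 0‖).add hγ).const_mul M).mono'
      (hu.smul (continuous_kerSection hc hc')).aestronglyMeasurable (.of_forall fun x => ?_)
    rw [norm_smul]
    exact mul_le_mul (hM x) (norm_kerSection_le hc hc' x) (norm_nonneg _)
      ((abs_nonneg _).trans (hM x))
  -- The embedding represents integration against u γ by the reproducing property, so Cauchy–Schwarz
  -- leaves only ‖m‖.
  set m : NetRKHS d c := ∫ x, u x • NetRKHS.kerSection d c x ∂γ with hm
  have hrep : ∀ G : NetRKHS d c, inner ℝ G m = ∫ x, u x * G x ∂γ := fun G => by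
    rw [hm, ← integral_inner hint]
    refine integral_congr_ae (.of_forall fun x => ?_)
    simp only [inner_smul_right]
    rw [real_inner_comm, inner_kerSection]
  have hfeat : ∀ x : Euc d, Continuous fun z => feature c x z := fun x =>
    continuous_feature.comp (by fun_prop : Continuous fun z => (x, z))
  have hval : ∀ x, m x = ∫ z, feature c x z * featureCoeff c γ u z ∂(featureMeasure d) := fun x => by
    rw [← inner_kerSection, hrep]
    have h := integral_mul_integral_feature (B := ‖x‖) (A := 1) hc hc' hu hM hγ
      (hfeat x).stronglyMeasurable (fun z => by rw [one_mul]; exact abs_feature_le hc hc' x z)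
    simp_rw [mul_comm (feature c x _)]
    rw [← h]
    refine integral_congr_ae (.of_forall fun y => ?_)
    simp only
    rw [← inner_kerSection, inner_kerSection_kerSection, netKernel_eq]
  have hnorm : ‖m‖ ^ 2 = ∫ z, featureCoeff c γ u z ^ 2 ∂(featureMeasure d) := by
    rw [← real_inner_self_eq_norm_sq, hrep]
    simp_rw [hval, sq]
    exact integral_mul_integral_feature hc hc' hu hM hγ (stronglyMeasurable_featureCoeff hu)
      (fun z => abs_featureCoeff_le hc hc' hM hγ z)
  rw [← hrep, ← hnorm, Real.sqrt_sq (norm_nonneg _)]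
  refine (abs_real_inner_le_norm _ _).trans ?_
  exact mul_le_of_le_one_left (norm_nonneg _) hG

end embedding

/-! ### The upper bound over the RKHS unit ball. -/

lemma integral_sq_gaussianReal (v : ℝ≥0) : ∫ x, x ^ 2 ∂(gaussianReal 0 v) = v := by
  have h := variance_eq_sub (memLp_id_gaussianReal (μ := 0) (v := v) 2)
  rw [variance_id_gaussianReal] at h
  simpa using h.symm

lemma integrable_sq_gaussianReal (v : ℝ≥0) : Integrable (fun x => x ^ 2) (gaussianReal 0 v) :=
  (memLp_id_gaussianReal (μ := 0) (v := v) 2).integrable_sq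

section

variable {d : ℕ} {c s : ℝ}

lemma integrable_inner_sq_gaussScaled (θ : Euc d) :
    Integrable (fun x : Euc d => (inner ℝ θ x : ℝ) ^ 2) (gaussScaled d s) := by
  have h := integrable_sq_gaussianReal (‖θ‖ ^ 2 / s ^ 2).toNNReal
  rw [← map_inner_gaussScaled] at h
  exact h.comp_measurable (by fun_prop)

lemma integral_inner_sq_gaussScaled (θ : Euc d) :
    ∫ x : Euc d, (inner ℝ θ x : ℝ) ^ 2 ∂(gaussScaled d s) = ‖θ‖ ^ 2 / s ^ 2 := by
  have h := integral_sq_gaussianReal (‖θ‖ ^ 2 / s ^ 2).toNNReal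
  rw [← map_inner_gaussScaled, integral_map (by fun_prop) (by fun_prop),
    Real.coe_toNNReal _ (by positivity)] at h
  exact h

lemma integrable_inner_gaussScaled (θ : Euc d) :
    Integrable (fun x : Euc d => (inner ℝ θ x : ℝ)) (gaussScaled d s) :=
  (IsGaussian.integrable_id (μ := gaussScaled d s)).const_inner θ

lemma integral_abs_inner_gaussScaled_le (hs : 0 < s) {θ : Euc d} (hθ : ‖θ‖ = 1) :
    ∫ x : Euc d, |(inner ℝ θ x : ℝ)| ∂(gaussScaled d s) ≤ 1 / s := by
  have hi := integrable_inner_sq_gaussScaled (s := s) θ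
  calc _ ≤ ∫ x : Euc d, (s / 2 * (inner ℝ θ x : ℝ) ^ 2 + 1 / (2 * s)) ∂(gaussScaled d s) := by
        refine integral_mono (integrable_inner_gaussScaled θ).abs
          ((hi.const_mul _).add (integrable_const _)) fun x => ?_
        simp only
        rw [← sq_abs, ← sub_nonneg]
        have : s / 2 * |(inner ℝ θ x : ℝ)| ^ 2 + 1 / (2 * s) - |(inner ℝ θ x : ℝ)|
            = (s * |(inner ℝ θ x : ℝ)| - 1) ^ 2 / (2 * s) := by field_simp; ring
        rw [this]; positivity
    _ = 1 / s := by
        rw [integral_add (hi.const_mul _) (integrable_const _), integral_const_mul,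
          integral_inner_sq_gaussScaled, hθ]
        simp only [integral_const, probReal_univ, one_smul]
        field_simp
        norm_num

lemma integrable_act_inner_sub (hc : -1 < c) (hc' : c ≤ 0) (θ : Euc d) (b : ℝ)
    {μ : Measure (Euc d)} [IsFiniteMeasure μ] (hμ : Integrable (fun x : Euc d => ‖x‖) μ) :
    Integrable (fun x : Euc d => act c (inner ℝ θ x - b)) μ := by
  refine ((hμ.const_mul ‖θ‖).add (integrable_const |b|)).mono'
    ((continuous_act c).comp (by fun_prop)).aestronglyMeasurable (.of_forall fun x => ?_)
  refine (abs_act_le_abs hc hc' _).trans ((abs_sub _ _).trans ?_)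
  exact add_le_add_left (abs_real_inner_le_norm θ x) _

variable [NeZero d]

lemma featureCoeff_sq_le (hc : -1 < c) (hc' : c ≤ 0) (hs : 0 < s)
    (z : Metric.sphere (0 : Euc d) 1 × ℝ) :
    featureCoeff c (gaussScaled d s) (fun x => 2 * Real.sin (√d * x 0)) z ^ 2
      ≤ Real.exp (-(d / s ^ 2 * (1 - inner ℝ (EuclideanSpace.single 0 1) (z.1 : Euc d) ^ 2)))
        * (8 * (1 / s ^ 2 + z.2 ^ 2)) := by
  set e : Euc d := EuclideanSpace.single 0 1
  set θ : Euc d := (z.1 : Euc d)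
  have hθ : ‖θ‖ = 1 := by simp [θ]
  have he : ‖e‖ = 1 := by simp [e]
  have hi := integrable_act_inner_sub hc hc' θ z.2 (integrable_norm_gaussScaled d s)
  have h := abs_integral_sin_mul_le (s := s) hθ (√d • e) (f := fun t => act c (t - z.2))
    ((continuous_act c).comp (by fun_prop)) hi
  have hd : (√(d : ℝ)) ^ 2 = d := Real.sq_sqrt (Nat.cast_nonneg d)
  have hexp : -((‖√(d : ℝ) • e‖ ^ 2 - inner ℝ θ (√(d : ℝ) • e) ^ 2) / s ^ 2) / 2
      = -(d / s ^ 2 * (1 - inner ℝ e θ ^ 2)) / 2 := by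
    rw [norm_smul, he, inner_smul_right, mul_one, mul_pow, Real.norm_eq_abs, sq_abs, hd,
      real_inner_comm]
    ring
  rw [hexp] at h
  have hU : ∫ x : Euc d, |act c (inner ℝ θ x - z.2)| ∂(gaussScaled d s) ≤ 1 / s + |z.2| := by
    have hu := (integrable_inner_gaussScaled (s := s) θ).abs
    calc _ ≤ ∫ x : Euc d, (|(inner ℝ θ x : ℝ)| + |z.2|) ∂(gaussScaled d s) :=
          integral_mono hi.abs (hu.add (integrable_const _)) fun x =>
            (abs_act_le_abs hc hc' _).trans (abs_sub _ _)
      _ = ∫ x : Euc d, |(inner ℝ θ x : ℝ)| ∂(gaussScaled d s) + |z.2| := by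
          rw [integral_add hu (integrable_const _)]; simp
      _ ≤ _ := by gcongr; exact integral_abs_inner_gaussScaled_le hs hθ
  have hcoef : featureCoeff c (gaussScaled d s) (fun x => 2 * Real.sin (√d * x 0)) z
      = 2 * ∫ x, Real.sin (inner ℝ (√(d : ℝ) • e) x) * act c (inner ℝ θ x - z.2)
          ∂(gaussScaled d s) := by
    rw [featureCoeff, ← integral_const_mul]
    refine integral_congr_ae (.of_forall fun x => ?_)
    simp only [inner_smul_left, e, inner_single_zero, feature, θ, conj_trivial]
    ring
  have hexp2 : Real.exp (-(d / s ^ 2 * (1 - inner ℝ e θ ^ 2)))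
      = Real.exp (-(d / s ^ 2 * (1 - inner ℝ e θ ^ 2)) / 2) ^ 2 := by
    rw [← Real.exp_nat_mul]; congr 1; push_cast; ring
  rw [hcoef, hexp2, mul_pow, ← sq_abs (∫ x, _ ∂_)]
  have h2 := h.trans (mul_le_mul_of_nonneg_left hU (Real.exp_pos _).le)
  have h3 := pow_le_pow_left₀ (abs_nonneg _) h2 2
  have h4 : (1 / s + |z.2|) ^ 2 ≤ 2 * (1 / s ^ 2 + z.2 ^ 2) := by
    rw [← sq_abs z.2, show 1 / s ^ 2 = (1 / s) ^ 2 by ring]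
    nlinarith [sq_nonneg (1 / s - |z.2|)]
  rw [mul_pow] at h3
  have h5 := mul_le_mul_of_nonneg_left h4
    (sq_nonneg (Real.exp (-(d / s ^ 2 * (1 - inner ℝ e θ ^ 2)) / 2)))
  linarith

/-- The pointwise bound is a product of a function of θ and a function of b, so it integrates factor
by factor against τ; the bias has second moment 1. -/
lemma integral_featureCoeff_sq_le (hc : -1 < c) (hc' : c ≤ 0) (hs : 0 < s) :
    ∫ z, featureCoeff c (gaussScaled d s) (fun x => 2 * Real.sin (√d * x 0)) z ^ 2
        ∂(featureMeasure d)
      ≤ (2 * Real.exp (-d / 8) + Real.exp (-(3 / 4 * (d / s ^ 2)))) * (8 * (1 / s ^ 2 + 1)) := by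
  have := isProbabilityMeasure_unifSphere d
  have he : ‖(EuclideanSpace.single 0 1 : Euc d)‖ = 1 := by simp
  have hg := integrable_sq_gaussianReal 1
  have hI : Integrable (fun z : Metric.sphere (0 : Euc d) 1 =>
      Real.exp (-(d / s ^ 2 * (1 - inner ℝ (EuclideanSpace.single 0 1) (z : Euc d) ^ 2))))
      (unifSphere d) := by
    refine (integrable_const (1 : ℝ)).mono'
      (Continuous.aestronglyMeasurable (by fun_prop)) (.of_forall fun z => ?_)
    rw [Real.norm_eq_abs, abs_of_pos (Real.exp_pos _), Real.exp_le_one_iff, neg_nonpos]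
    have hz : |(inner ℝ (EuclideanSpace.single 0 1) (z : Euc d) : ℝ)| ≤ 1 := by
      simpa [he] using abs_real_inner_le_norm (EuclideanSpace.single 0 1) (z : Euc d)
    have hz2 : (inner ℝ (EuclideanSpace.single 0 1) (z : Euc d) : ℝ) ^ 2 ≤ 1 := by
      rw [← sq_abs]; exact pow_le_one₀ (abs_nonneg _) hz
    exact mul_nonneg (by positivity) (by linarith)
  have hJ : Integrable (fun b : ℝ => 8 * (1 / s ^ 2 + b ^ 2)) (gaussianReal 0 1) :=
    ((integrable_const _).add hg).const_mul 8
  calc _ ≤ ∫ z, Real.exp (-(d / s ^ 2 *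
          (1 - inner ℝ (EuclideanSpace.single 0 1) (z.1 : Euc d) ^ 2)))
        * (8 * (1 / s ^ 2 + z.2 ^ 2)) ∂(featureMeasure d) :=
        integral_mono_of_nonneg (.of_forall fun z => sq_nonneg _) (hI.mul_prod hJ)
          (.of_forall fun z => featureCoeff_sq_le hc hc' hs z)
    _ = (∫ z, Real.exp (-(d / s ^ 2 *
          (1 - inner ℝ (EuclideanSpace.single 0 1) (z : Euc d) ^ 2))) ∂(unifSphere d))
        * (8 * (1 / s ^ 2 + 1)) := by
        rw [featureMeasure, integral_prod_mul (f := fun z : Metric.sphere (0 : Euc d) 1 =>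
          Real.exp (-(d / s ^ 2 * (1 - inner ℝ (EuclideanSpace.single 0 1) (z : Euc d) ^ 2))))
          (g := fun b : ℝ => 8 * (1 / s ^ 2 + b ^ 2)), integral_const_mul,
          integral_add (integrable_const _) hg, integral_sq_gaussianReal]
        simp
    _ ≤ _ := by
        gcongr
        exact integral_exp_unifSphere_le d he (by positivity)

/-- The constant in the upper bound over the unit ball of the reproducing kernel Hilbert space. -/
noncomputable def rkhsConst (x₀ : ℝ) : ℝ :=
  √((2 + Real.exp (√Real.pi * x₀ * Real.exp (x₀ ^ 2 / 12) / 8)) * (8 * (4 / x₀ ^ 2 + 1)))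

lemma rkhsConst_pos (x₀ : ℝ) : 0 < rkhsConst x₀ := by
  unfold rkhsConst; positivity

lemma NetRKHS.abs_integral_sub_le {x₀ : ℝ} (hx₀ : 0 < x₀) (hc : -1 < c) (hc' : c ≤ 0)
    (h : IsScale x₀ d s) {μ ν : Measure (Euc d)} (hp : IsSinePair d √d s μ ν) (G : NetRKHS d c)
    (hG : ‖G‖ ≤ 1) :
    Integrable (fun x => G x) μ ∧ Integrable (fun x => G x) ν ∧
      |∫ x, G x ∂μ - ∫ x, G x ∂ν| ≤ rkhsConst x₀ * (d * Real.exp (-(√d - 1) ^ 2 / 16)) := by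
  have := hp.prob_left
  have := hp.prob_right
  have hμ := integrable_coe hc hc' G hp.moment_left
  have hν := integrable_coe hc hc' G hp.moment_right
  refine ⟨hμ, hν, ?_⟩
  have hd : 1 ≤ d := NeZero.one_le
  have hd1 : (1 : ℝ) ≤ d := by exact_mod_cast hd
  rw [hp.integral_sub h.1 hμ hν]
  refine (abs_integral_mul_le (M := 2) hc hc' (by fun_prop) (fun x => ?_)
    (integrable_norm_gaussScaled d s) G hG).trans ?_
  · rw [abs_mul, abs_two]
    exact mul_le_of_le_one_right (by norm_num) (Real.abs_sin_le_one _)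
  set C₁ := Real.exp (√Real.pi * x₀ * Real.exp (x₀ ^ 2 / 12) / 8)
  have h1 := h.exp_neg_div_sq_le hx₀ hd
  have h2 := h.inv_sq_le hx₀ hd
  have hle : ∫ z, featureCoeff c (gaussScaled d s) (fun x => 2 * Real.sin (√d * x 0)) z ^ 2
        ∂(featureMeasure d)
      ≤ (2 + C₁) * (8 * (4 / x₀ ^ 2 + 1)) * (d * Real.exp (-(√d - 1) ^ 2 / 16)) ^ 2 := by
    -- Holds because 0 ≤ √d − 1 ≤ √d; the square is undone by the final square root.
    have h3 : Real.exp (-d / 8) ≤ Real.exp (-(√d - 1) ^ 2 / 16) ^ 2 := by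
      rw [← Real.exp_nat_mul, Real.exp_le_exp]
      have hsq : √(d : ℝ) ^ 2 = d := Real.sq_sqrt (Nat.cast_nonneg d)
      have h1d : 1 ≤ √(d : ℝ) := Real.one_le_sqrt.2 hd1
      push_cast
      nlinarith
    have h4 : 1 / s ^ 2 + 1 ≤ (4 / x₀ ^ 2 + 1) * (d : ℝ) ^ 2 := by
      have : (1 : ℝ) ≤ (d : ℝ) ^ 2 := one_le_pow₀ hd1
      have e : (4 / x₀ ^ 2 + 1) * (d : ℝ) ^ 2 = 4 * (d : ℝ) ^ 2 / x₀ ^ 2 + (d : ℝ) ^ 2 := by ring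
      linarith
    calc _ ≤ _ := integral_featureCoeff_sq_le hc hc' h.1
      _ ≤ (2 * Real.exp (-d / 8) + C₁ * Real.exp (-d / 8))
          * (8 * ((4 / x₀ ^ 2 + 1) * (d : ℝ) ^ 2)) := by gcongr
      _ = (2 + C₁) * (8 * (4 / x₀ ^ 2 + 1)) * (d ^ 2 * Real.exp (-d / 8)) := by ring
      _ ≤ _ := by rw [mul_pow]; gcongr
  refine (Real.sqrt_le_sqrt hle).trans_eq ?_
  rw [Real.sqrt_mul (by positivity), Real.sqrt_sq (by positivity), rkhsConst]

end

/-! ### The lower bound: a three-neuron hat network. -/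

/-- The hat function supported on `[0, 2h]` with peak `h`. -/
noncomputable def hat (h t : ℝ) : ℝ := max (h - |t - h|) 0

lemma act_second_difference {h : ℝ} (hh : 0 ≤ h) (c t : ℝ) :
    act c t - 2 * act c (t - h) + act c (t - 2 * h) = (1 + c) * hat h t := by
  have key : |t| - 2 * |t - h| + |t - 2 * h| = 2 * hat h t := by
    unfold hat
    rcases le_total 0 t with h0 | h0 <;> rcases le_total h t with h1 | h1 <;>
      rcases le_total (2 * h) t with h2 | h2
    all_goals
      first
      | rw [abs_of_nonneg (by linarith : 0 ≤ t)]
      | rw [abs_of_nonpos (by linarith : t ≤ 0)]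
      first
      | rw [abs_of_nonneg (by linarith : 0 ≤ t - h)]
      | rw [abs_of_nonpos (by linarith : t - h ≤ 0)]
      first
      | rw [abs_of_nonneg (by linarith : 0 ≤ t - 2 * h)]
      | rw [abs_of_nonpos (by linarith : t - 2 * h ≤ 0)]
      first
      | rw [max_eq_left (by linarith)]; linarith
      | rw [max_eq_right (by linarith)]; linarith
  rw [act_eq, act_eq, act_eq]
  linear_combination (1 + c) / 2 * key

lemma half_le_sin {y : ℝ} (h1 : Real.pi / 4 ≤ y) (h2 : y ≤ 3 * Real.pi / 4) :
    1 / 2 ≤ Real.sin y := by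
  have hpi := Real.pi_pos
  have key : ∀ y, Real.pi / 4 ≤ y → y ≤ Real.pi / 2 → 1 / 2 ≤ Real.sin y := fun y h1 h2 => by
    refine le_trans ?_ (Real.mul_le_sin (by linarith) h2)
    rw [div_mul_eq_mul_div, div_le_div_iff₀ (by norm_num) hpi]
    linarith
  rcases le_total y (Real.pi / 2) with h | h
  · exact key y h1 h
  · rw [← Real.sin_pi_sub]
    exact key _ (by linarith) (by linarith)

/-- The support [0, 2h] with h = π/(2l) is half a period, so the product is nonnegative; on the
middle half the sine is at least 1/2 and the hat at least h/2. -/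
lemma indicator_le_sin_mul_hat {l : ℝ} (hl : 0 < l) (t : ℝ) :
    (Set.Icc (Real.pi / (2 * l) / 2) (3 * (Real.pi / (2 * l)) / 2)).indicator
        (fun _ => Real.pi / (2 * l) / 4) t
      ≤ Real.sin (l * t) * hat (Real.pi / (2 * l)) t := by
  have hpi := Real.pi_pos
  set h := Real.pi / (2 * l)
  have hh : 0 < h := by positivity
  have hlh : l * h = Real.pi / 2 := by simp only [h]; field_simp
  by_cases ht : t ∈ Set.Icc (h / 2) (3 * h / 2)
  · rw [Set.indicator_of_mem ht]
    have h1 := mul_le_mul_of_nonneg_left ht.1 hl.le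
    have h2 := mul_le_mul_of_nonneg_left ht.2 hl.le
    have hs : 1 / 2 ≤ Real.sin (l * t) := half_le_sin (by linarith) (by linarith)
    have ha : h / 2 ≤ hat h t := by
      refine le_max_of_le_left ?_
      have : |t - h| ≤ h / 2 := abs_le.2 ⟨by linarith [ht.1], by linarith [ht.2]⟩
      linarith
    nlinarith [mul_le_mul hs ha (by positivity) (by linarith)]
  · rw [Set.indicator_of_notMem ht]
    rcases le_total (h - |t - h|) 0 with h0 | h0
    · simp [hat, max_eq_right h0]
    · have h1 := abs_le.1 (sub_nonneg.1 h0)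
      have h2 := mul_le_mul_of_nonneg_left (by linarith : t ≤ 2 * h) hl.le
      refine mul_nonneg (Real.sin_nonneg_of_nonneg_of_le_pi ?_ (by linarith)) (le_max_right _ _)
      exact mul_nonneg hl.le (by linarith)

/-- The centred density decreases on the positive axis, so its minimum over the interval is at b. -/
lemma gaussianReal_Icc_ge {v : ℝ≥0} (hv : v ≠ 0) {a b : ℝ} (ha : 0 ≤ a) (hab : a ≤ b) :
    (b - a) * gaussianPDFReal 0 v b ≤ (gaussianReal 0 v).real (Set.Icc a b) := by
  rw [measureReal_def, gaussianReal_apply_eq_integral _ hv,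
    ENNReal.toReal_ofReal (integral_nonneg fun x => gaussianPDFReal_nonneg _ _ _)]
  have hc : (b - a) * gaussianPDFReal 0 v b
      = ∫ _ in Set.Icc a b, gaussianPDFReal 0 v b := by
    rw [setIntegral_const, Real.volume_real_Icc_of_le hab, smul_eq_mul]
  rw [hc]
  refine setIntegral_mono_on (integrableOn_const (by simp))
    (integrable_gaussianPDFReal 0 v).integrableOn measurableSet_Icc fun x hx => ?_
  have hx0 : 0 ≤ x := ha.trans hx.1
  have hxb := hx.2
  simp only [gaussianPDFReal, sub_zero]
  gcongr

lemma integrable_eval {d : ℕ} {c : ℝ} (hc : -1 < c) (hc' : c ≤ 0) (W : TwoLayerNet d) {μ : Measure (Euc d)}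
    [IsFiniteMeasure μ] (hμ : Integrable (fun x : Euc d => ‖x‖) μ) :
    Integrable (W.eval c) μ :=
  (integrable_finsetSum _ fun i _ =>
    (integrable_act_inner_sub hc hc' (W.θ i) (W.b i) hμ).const_mul _).add (integrable_const _)

section

variable {d : ℕ} [NeZero d] {c s : ℝ}

lemma integral_sin_mul_hat_ge (hs : 0 < s) {l : ℝ} (hl : 0 < l) :
    (Real.pi / (2 * l)) ^ 2 / 4 * (s / √(2 * Real.pi) *
        Real.exp (-(s * (3 * (Real.pi / (2 * l)) / 2)) ^ 2 / 2))
      ≤ ∫ x : Euc d, Real.sin (l * x 0) * hat (Real.pi / (2 * l)) (x 0) ∂(gaussScaled d s) := by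
  have hpi := Real.pi_pos
  set h := Real.pi / (2 * l) with hdef
  have hh : 0 < h := by positivity
  set v : ℝ≥0 := (1 / s ^ 2).toNNReal
  have hvr : (v : ℝ) = 1 / s ^ 2 := Real.coe_toNNReal _ (by positivity)
  have hv : v ≠ 0 := by
    rw [ne_eq, ← NNReal.coe_eq_zero, hvr]; positivity
  have hmap : (gaussScaled d s).map (fun x : Euc d => x 0) = gaussianReal 0 v := by
    have := map_inner_gaussScaled (s := s) (EuclideanSpace.single (0 : Fin d) (1 : ℝ))
    simpa [inner_single_zero, v] using this
  have hA : MeasurableSet (Set.Icc (h / 2) (3 * h / 2)) := measurableSet_Icc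
  have hhat : Continuous (hat h) := by unfold hat; fun_prop
  have hI : Integrable (fun t => Real.sin (l * t) * hat h t) (gaussianReal 0 v) := by
    refine (integrable_const h).mono'
      (Continuous.aestronglyMeasurable (by fun_prop)) (.of_forall fun t => ?_)
    have h1 : |hat h t| ≤ h := by
      rw [hat, abs_of_nonneg (le_max_right _ _)]
      exact max_le (by linarith [abs_nonneg (t - h)]) hh.le
    rw [Real.norm_eq_abs, abs_mul]
    nlinarith [Real.abs_sin_le_one (l * t), abs_nonneg (hat h t), abs_nonneg (Real.sin (l * t))]
  have hmono := integral_mono (μ := gaussianReal 0 v)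
    ((integrable_const (h / 4)).indicator hA) hI (indicator_le_sin_mul_hat hl)
  rw [integral_indicator_const _ hA, smul_eq_mul] at hmono
  have hpdf : s / √(2 * Real.pi) * Real.exp (-(s * (3 * h / 2)) ^ 2 / 2)
      = gaussianPDFReal 0 v (3 * h / 2) := by
    rw [gaussianPDFReal, hvr, sub_zero]
    congr 1
    · rw [mul_one_div, Real.sqrt_div (by positivity), Real.sqrt_sq hs.le, inv_div]
    · congr 1; field_simp
  have hge := gaussianReal_Icc_ge hv (a := h / 2) (b := 3 * h / 2) (by positivity) (by linarith)
  rw [← integral_map (f := fun t => Real.sin (l * t) * hat h t) (φ := fun x : Euc d => x 0)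
    (by fun_prop) (Continuous.aestronglyMeasurable (by fun_prop)), hmap, hpdf]
  refine le_trans ?_ hmono
  rw [show 3 * h / 2 - h / 2 = h by ring] at hge
  nlinarith [mul_le_mul_of_nonneg_right hge hh.le]

/-- The network computing `α (1 + c)` times the hat function of the first coordinate. -/
noncomputable def hatNet (d : ℕ) [NeZero d] (h α : ℝ) : TwoLayerNet d where
  m := 3
  w := ![α, -2 * α, α]
  θ := fun _ => EuclideanSpace.single 0 1
  b := ![0, h, 2 * h]
  w₀ := 0

lemma eval_hatNet {h : ℝ} (hh : 0 ≤ h) (α : ℝ) (x : Euc d) :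
    (hatNet d h α).eval c x = α * (1 + c) * hat h (x 0) := by
  rw [mul_assoc, ← act_second_difference hh]
  change ∑ i : Fin 3, ![α, -2 * α, α] i *
    act c (inner ℝ (EuclideanSpace.single 0 1) x - ![0, h, 2 * h] i) + 0 = _
  simp only [Fin.sum_univ_three, inner_single_zero]
  simp
  ring

lemma pathNormNoBias_hatNet (h : ℝ) {α : ℝ} (hα : 0 ≤ α) :
    (hatNet d h α).pathNormNoBias = 4 * α := by
  change ∑ i : Fin 3, |![α, -2 * α, α] i| * ‖(EuclideanSpace.single 0 1 : Euc d)‖ = _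
  simp [Fin.sum_univ_three, abs_of_nonneg hα]
  ring

lemma pathNormBias_hatNet (h : ℝ) {α : ℝ} (hα : 0 ≤ α) :
    (hatNet d h α).pathNormBias = α * (1 + 2 * √(1 + h ^ 2) + √(1 + (2 * h) ^ 2)) := by
  change ∑ i : Fin 3, |![α, -2 * α, α] i| *
    √(‖(EuclideanSpace.single 0 1 : Euc d)‖ ^ 2 + ![0, h, 2 * h] i ^ 2) + |(0 : ℝ)| = _
  simp [Fin.sum_univ_three, abs_of_nonneg hα]
  ring

/-- The constant in the lower bound attained by two-layer networks. -/
noncomputable def netConst (x₀ c : ℝ) : ℝ :=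
  (1 + c) * Real.pi ^ 2 * x₀ * Real.exp (-18 * x₀ ^ 2) / (512 * √(2 * Real.pi))

lemma netConst_pos {x₀ : ℝ} (hx₀ : 0 < x₀) (hc : -1 < c) : 0 < netConst x₀ c := by
  have := Real.pi_pos
  have : 0 < 1 + c := by linarith
  unfold netConst; positivity

lemma netConst_div_le {x₀ : ℝ} (hx₀ : 0 < x₀) (hc : -1 < c) (hc' : c ≤ 0)
    (h : IsScale x₀ d s) (hd : 2 ≤ d) {μ ν : Measure (Euc d)} (hp : IsSinePair d √d s μ ν)
    {α : ℝ} (hα : 1 / 16 ≤ α) :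
    netConst x₀ c / (d * Real.log d)
      ≤ |∫ x, (hatNet d (Real.pi / (2 * √d)) α).eval c x ∂μ
          - ∫ x, (hatNet d (Real.pi / (2 * √d)) α).eval c x ∂ν| := by
  have := hp.prob_left
  have := hp.prob_right
  have hpi := Real.pi_pos
  have hd1 : (1 : ℝ) ≤ d := by exact_mod_cast (by omega : 1 ≤ d)
  have hl : 0 < √(d : ℝ) := by positivity
  have hl2 : √(d : ℝ) ^ 2 = d := Real.sq_sqrt (Nat.cast_nonneg d)
  have hl1 : 1 ≤ √(d : ℝ) := Real.one_le_sqrt.2 hd1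
  have hlog : 0 < Real.log d := Real.log_pos (by exact_mod_cast (by omega : 1 < d))
  have hs := h.1
  have hc0 : 0 < 1 + c := by linarith
  have hge := integral_sin_mul_hat_ge (d := d) hs hl
  -- With s ≤ 2x₀ and h ≤ 2, the endpoint satisfies s · 3h/2 ≤ 6x₀, and half its square is at most
  -- 18x₀².
  have hexp : Real.exp (-18 * x₀ ^ 2)
      ≤ Real.exp (-(s * (3 * (Real.pi / (2 * √d)) / 2)) ^ 2 / 2) := by
    rw [Real.exp_le_exp]
    have h1 : Real.pi / (2 * √d) ≤ 2 := by
      rw [div_le_iff₀ (by positivity)]; linarith [Real.pi_le_four]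
    have h2 : s * (3 * (Real.pi / (2 * √d)) / 2) ≤ 2 * x₀ * 3 :=
      mul_le_mul (h.le_two_mul hx₀ (by omega)) (by linarith) (by positivity) (by positivity)
    have h3 := pow_le_pow_left₀ (by positivity) h2 2
    linarith
  rw [hp.integral_sub hs (integrable_eval hc hc' _ hp.moment_left)
    (integrable_eval hc hc' _ hp.moment_right)]
  refine le_trans ?_ (le_abs_self _)
  have heq : ∫ x : Euc d, 2 * Real.sin (√d * x 0) *
        (hatNet d (Real.pi / (2 * √d)) α).eval c x ∂(gaussScaled d s)
      = 2 * α * (1 + c) * ∫ x : Euc d, Real.sin (√d * x 0) * hat (Real.pi / (2 * √d)) (x 0)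
          ∂(gaussScaled d s) := by
    rw [← integral_const_mul]
    refine integral_congr_ae (.of_forall fun x => ?_)
    simp only [eval_hatNet (by positivity : 0 ≤ Real.pi / (2 * √(d : ℝ)))]
    ring
  rw [heq]
  calc netConst x₀ c / (d * Real.log d)
      = 2 * (1 / 16) * (1 + c) * ((Real.pi / (2 * √d)) ^ 2 / 4 *
          (x₀ / (4 * Real.log d) / √(2 * Real.pi) * Real.exp (-18 * x₀ ^ 2))) := by
        rw [netConst, div_pow, mul_pow, hl2]; field_simp; norm_num
    _ ≤ 2 * α * (1 + c) * ((Real.pi / (2 * √d)) ^ 2 / 4 * (s / √(2 * Real.pi) *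
          Real.exp (-(s * (3 * (Real.pi / (2 * √d)) / 2)) ^ 2 / 2))) := by
        gcongr
        exact h.div_log_le hx₀ hd
    _ ≤ _ := by gcongr

end

theorem mainTheorem6 (x₀ : ℝ) (hx₀ : 0 < x₀) (c : ℝ) (hc : -1 < c) (hc' : c ≤ 0) :
    (∀ d : ℕ, 1 ≤ d → ∃! s : ℝ, IsScale x₀ d s) ∧
    ∃ K C : ℝ, 0 < K ∧ 0 < C ∧
      ∀ (d : ℕ) [NeZero d] (s : ℝ), IsScale x₀ d s →
        (∃ μ ν : Measure (Euc d), IsSinePair d √d s μ ν) ∧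
        ∀ μ ν : Measure (Euc d), IsSinePair d √d s μ ν →
          (2 ≤ d →
            (∃ W : TwoLayerNet d, W.pathNormNoBias = 1 ∧
              Integrable (W.eval c) μ ∧ Integrable (W.eval c) ν ∧
              K / (d * Real.log d) ≤ |∫ x, W.eval c x ∂μ - ∫ x, W.eval c x ∂ν|) ∧
            (∃ W : TwoLayerNet d, W.pathNormBias = 1 ∧
              Integrable (W.eval c) μ ∧ Integrable (W.eval c) ν ∧
              K / (d * Real.log d) ≤ |∫ x, W.eval c x ∂μ - ∫ x, W.eval c x ∂ν|)) ∧
          (∀ G : NetRKHS d c, ‖G‖ ≤ 1 →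
            Integrable (fun x => G x) μ ∧ Integrable (fun x => G x) ν ∧
            |∫ x, G x ∂μ - ∫ x, G x ∂ν| ≤
              C * (d * Real.exp (-(√d - 1) ^ 2 / 16))) := by
  refine ⟨fun d hd => IsScale.existsUnique hx₀ hd, netConst x₀ c, rkhsConst x₀,
    netConst_pos hx₀ hc, rkhsConst_pos x₀, fun d _ s h => ⟨exists_isSinePair h.1 _,
    fun μ ν hp => ⟨fun hd => ?_, fun G hG => NetRKHS.abs_integral_sub_le hx₀ hc hc' h hp G hG⟩⟩⟩
  have := hp.prob_left
  have := hp.prob_right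
  have hW : ∀ W : TwoLayerNet d, Integrable (W.eval c) μ ∧ Integrable (W.eval c) ν := fun W =>
    ⟨integrable_eval hc hc' W hp.moment_left, integrable_eval hc hc' W hp.moment_right⟩
  have hl1 : 1 ≤ √(d : ℝ) := Real.one_le_sqrt.2 (by exact_mod_cast (by omega : 1 ≤ d))
  have hpi := Real.pi_pos
  set η : ℝ := Real.pi / (2 * √d) with hη
  have hη0 : 0 ≤ η := by positivity
  have hη2 : η ≤ 2 := by
    rw [hη, div_le_iff₀ (by positivity)]; linarith [Real.pi_le_four]
  set P : ℝ := 1 + 2 * √(1 + η ^ 2) + √(1 + (2 * η) ^ 2) with hP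
  have hP0 : 0 < P := by positivity
  have hP16 : P ≤ 16 := by
    have h1 : √(1 + η ^ 2) ≤ 5 := Real.sqrt_le_iff.2 ⟨by norm_num, by nlinarith⟩
    have h2 : √(1 + (2 * η) ^ 2) ≤ 5 := Real.sqrt_le_iff.2 ⟨by norm_num, by nlinarith⟩
    linarith
  -- The weight is normalized by the path-norm per unit weight: 4 without bias and P ≤ 16 with bias.
  -- Either weight is at least 1/16, so one constant serves both.
  refine ⟨⟨hatNet d η (1 / 4), ?_, (hW _).1, (hW _).2, ?_⟩,
    ⟨hatNet d η (1 / P), ?_, (hW _).1, (hW _).2, ?_⟩⟩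
  · rw [pathNormNoBias_hatNet _ (by norm_num)]; norm_num
  · exact netConst_div_le hx₀ hc hc' h hd hp (by norm_num)
  · rw [pathNormBias_hatNet _ (by positivity), one_div, inv_mul_cancel₀ hP0.ne']
  · exact netConst_div_le hx₀ hc hc' h hd hp (one_div_le_one_div_of_le hP0 hP16)
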